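/- Let $a\in\mathbb{R}$ and let $\omega^{(\mathrm{pre})}(z)=(1+|z-a|^2)e^{-2|z|^2}$ for $z\in\mathbb{C}$. For polynomials $f,g$ with real coefficients put $$\langle f,g\rangle_s=\int_{\mathbb{C}}\bigl(f(z)\overline{g(z)}-g(z)\overline{f(z)}\bigr)(z-\overline z)\,\omega^{(\mathrm{pre})}(z)\,dA(z),\qquad dA(z)=\frac{d^2z}{\pi}.$$ A family $(q_k)_{k\ge 0}$ of polynomials with real coefficients, $\deg q_k=k$, is called a family of skew-orthogonal polynomials with respect to $\omega^{(\mathrm{pre})}$, with skew-norms $r_k>0$, if for all $k,\ell\ge 0$ $$\langle q_{2k},q_{2\ell}\rangle_s=\langle q_{2k+1},q_{2\ell+1}\rangle_s=0,\qquad \langle q_{2k},q_{2\ell+1}\rangle_s=-\langle q_{2\ell+1},q_{2k}\rangle_s=r_k\,\delta_{k,\ell}.$$ Such a family exists. Moreover, for every such family, every integer $N\ge 1$ and all $z,w\in\mathbb{C}$, the following holds. Let $$\varkappa_N^{(\mathrm{pre})}(z,w)=\sum_{k=0}^{N-1}\frac{q_{2k+1}(z)q_{2k}(w)-q_{2k}(z)q_{2k+1}(w)}{r_k},\qquad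 \widetilde\varkappa_N^{(\mathrm{pre})}(z,w)=e^{2a^2-2za-2wa}(z-a)^3(w-a)^3\varkappa_N^{(\mathrm{pre})}(z,w),$$ $$\mathfrak{D}_{z,a}=(z-a)\partial_z^2-\bigl(2(z-a)^2+2\bigr)\partial_z-2(z-a).$$ Then $$\mathfrak{D}_{z,a}\,\widetilde\varkappa_N^{(\mathrm{pre})}(z,w)=\mathrm{I}_N(z,w)-\mathrm{II}_N(z,w)-\mathrm{III}_N(z,w)+\mathrm{IV}_N(z,w),$$ where $$\mathrm{I}_N(z,w)=4(z-a)^3(w-a)^3e^{2(z-a)(w-a)}Q(2N,2zw),$$ $$\mathrm{II}_N(z,w)=4a(z-a)^3(w-a)^2e^{2a^2-2za-2wa}\biggl(\frac{(2zw)^{2N}}{(2N)!}+(2N+1-2az)\frac{2^{2N-1}e_N(a^2)(zw)^{2N}}{(2N)!\,f_N(a^2)}\biggr),$$ $$\mathrm{III}_N(z,w)=(z-a)^3e^{2a^2-2za}\,\frac{2N+1}{2}\,\frac{(2N+3)\widehat{\mathcal L}_{N+1}(w,a)-2a^2\widehat{\mathcal L}_N(w,a)}{N!\,f_N(a^2)}\,z^{2N},$$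 $$\mathrm{IV}_N(z,w)=(z-a)^3e^{2a^2-2za}\,za\,\frac{(2N+1)\widehat{\mathcal L}_{N+1}(w,a)-2a^2\widehat{\mathcal L}_N(w,a)}{N!\,f_N(a^2)}\,z^{2N}.$$ Here $$e_k(x)=\sum_{j=0}^k\frac{x^j}{j!},\qquad f_k(x)=\sum_{j=0}^k(k+1-j)\frac{x^j}{j!},\qquad Q(n,z)=\frac1{\Gamma(n)}\int_z^\infty t^{n-1}e^{-t}\,dt$$ (for integers $n\ge 1$ and $z\in\mathbb{C}$, along the ray $t=z+s$, $s>0$), and $$\widehat{\mathcal L}_k(z,a)=(z-a)^2\,\partial_z\biggl[\frac{e^{-2za}\varkappa_k^{(\mathrm g)}(z,a)}{z-a}\biggr]$$ (with $\widehat{\mathcal L}_k(a,a)=0$, its continuous extension), where $$\varkappa_k^{(\mathrm g)}(z,w)=\sqrt2\sum_{j=0}^{k-1}\sum_{\ell=0}^{j}\biggl(\frac{(\sqrt2 z)^{2j+1}}{(2j+1)!!}\frac{(\sqrt2 w)^{2\ell}}{(2\ell)!!}-\frac{(\sqrt2 w)^{2j+1}}{(2j+1)!!}\frac{(\sqrt2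 z)^{2\ell}}{(2\ell)!!}\biggr)$$ is the skew-kernel of the symplectic Ginibre ensemble (GinSE). -/

import Mathlib

open scoped Nat

noncomputable section

/-- The pre-overlap weight `ω(z) = (1 + |z - x|²) e^{-2|z|²}` with conditioning point `x`. -/
def preWeight (x z : ℂ) : ℝ := (1 + ‖z - x‖ ^ 2) * Real.exp (-2 * ‖z‖ ^ 2)

/-- The skew-product `⟨f, g⟩ = ∫ (f(z) conj(g(z)) - g(z) conj(f(z))) (z - conj z) ω(z) dA(z)`,
where `dA = d²z / π`, for polynomials with real coefficients. -/
def skewProduct (ω : ℂ → ℝ) (f g : Polynomial ℝ) : ℂ :=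
  (1 / (Real.pi : ℂ)) * ∫ z : ℂ,
    (Polynomial.aeval z f * starRingEnd ℂ (Polynomial.aeval z g)
      - Polynomial.aeval z g * starRingEnd ℂ (Polynomial.aeval z f))
      * (z - starRingEnd ℂ z) * (ω z : ℂ)

/-- `q` is a family of planar skew-orthogonal polynomials (with real coefficients, `q k` of
degree exactly `k`) with respect to the weight `ω`, with positive skew-norms `r`. -/
structure IsPlanarSOP (ω : ℂ → ℝ) (q : ℕ → Polynomial ℝ) (r : ℕ → ℝ) : Prop where
  degree_eq : ∀ k, (q k).degree = (k : WithBot ℕ)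
  norm_pos : ∀ k, 0 < r k
  even_even : ∀ k l, skewProduct ω (q (2 * k)) (q (2 * l)) = 0
  odd_odd : ∀ k l, skewProduct ω (q (2 * k + 1)) (q (2 * l + 1)) = 0
  even_odd : ∀ k l,
    skewProduct ω (q (2 * k)) (q (2 * l + 1)) = if k = l then (r k : ℂ) else 0
  odd_even : ∀ k l,
    skewProduct ω (q (2 * l + 1)) (q (2 * k)) = -(if k = l then (r k : ℂ) else 0)

/-- The skew-kernel
`ϰ_N(z,w) = ∑_{k<N} (q_{2k+1}(z) q_{2k}(w) - q_{2k}(z) q_{2k+1}(w)) / r_k`. -/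
def skewKernel (q : ℕ → Polynomial ℝ) (r : ℕ → ℝ) (N : ℕ) (z w : ℂ) : ℂ :=
  ∑ k ∈ Finset.range N,
    (Polynomial.aeval z (q (2 * k + 1)) * Polynomial.aeval w (q (2 * k))
      - Polynomial.aeval z (q (2 * k)) * Polynomial.aeval w (q (2 * k + 1))) / (r k : ℂ)

/-- The skew-kernel of the symplectic Ginibre ensemble. -/
def ginSEKernel (N : ℕ) (z w : ℂ) : ℂ :=
  ((√2 : ℝ) : ℂ) * ∑ k ∈ Finset.range N, ∑ l ∈ Finset.range (k + 1),
    ((((√2 : ℝ) : ℂ) * z) ^ (2 * k + 1) / (((2 * k + 1)‼ : ℕ) : ℂ)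
        * ((((√2 : ℝ) : ℂ) * w) ^ (2 * l) / (((2 * l)‼ : ℕ) : ℂ))
      - (((√2 : ℝ) : ℂ) * w) ^ (2 * k + 1) / (((2 * k + 1)‼ : ℕ) : ℂ)
        * ((((√2 : ℝ) : ℂ) * z) ^ (2 * l) / (((2 * l)‼ : ℕ) : ℂ)))

/-- `e^{-2za}` times the skew-kernel of the symplectic Ginibre ensemble at `(z, a)`. -/
def ginSEKernelHat (N : ℕ) (z a : ℂ) : ℂ := Complex.exp (-2 * z * a) * ginSEKernel N z a

/-- `(z - a)² ∂_z [ϰ̂_k(z,a) / (z - a)]`. At `z = a` the value is `0`, which is also the limit for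
`z → a`, because `ϰ̂_k(a,a) = 0`. -/
def LHat (k : ℕ) (z a : ℂ) : ℂ :=
  (z - a) ^ 2 * deriv (fun t : ℂ => ginSEKernelHat k t a / (t - a)) z

/-- The truncated exponential `e_k(x) = ∑_{j ≤ k} x^j / j!`. -/
def truncExp (k : ℕ) (x : ℂ) : ℂ := ∑ j ∈ Finset.range (k + 1), x ^ j / (j ! : ℂ)

/-- `f_k(x) = ∑_{j ≤ k} (k + 1 - j) x^j / j!`. -/
def fSum (k : ℕ) (x : ℂ) : ℂ :=
  ∑ j ∈ Finset.range (k + 1), ((k : ℂ) + 1 - (j : ℂ)) * (x ^ j / (j ! : ℂ))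

/-- The regularised incomplete gamma function `Q(n, z) = Γ(n)⁻¹ ∫_z^∞ t^{n-1} e^{-t} dt` for an
integer `n ≥ 1` and complex `z`. The integrand is entire in `t`; the path of integration is the
horizontal ray `t = z + s`, `s > 0`. -/
def regGammaQ (n : ℕ) (z : ℂ) : ℂ :=
  (1 / Complex.Gamma (n : ℂ)) *
    ∫ s : ℝ in Set.Ioi 0, (z + (s : ℂ)) ^ (n - 1) * Complex.exp (-(z + (s : ℂ)))

/-- The operator `(z - a) ∂² - (2 (z - a)² + 2) ∂ - 2 (z - a)` applied to `g`, at the point `z`. -/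
def preOperator (a : ℂ) (g : ℂ → ℂ) (z : ℂ) : ℂ :=
  (z - a) * deriv (deriv g) z - (2 * (z - a) ^ 2 + 2) * deriv g z - 2 * (z - a) * g z

/-- The rescaled kernel `e^{2a² - 2za - 2wa} (z - a)³ (w - a)³ ϰ(z,w)`. -/
def rescaledKernel (a : ℂ) (ϰ : ℂ → ℂ → ℂ) (z w : ℂ) : ℂ :=
  Complex.exp (2 * a ^ 2 - 2 * z * a - 2 * w * a) * (z - a) ^ 3 * (w - a) ^ 3 * ϰ z w

/-- The first inhomogeneous term. -/
def termI (a : ℂ) (N : ℕ) (z w : ℂ) : ℂ :=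
  4 * (z - a) ^ 3 * (w - a) ^ 3 * Complex.exp (2 * (z - a) * (w - a))
    * regGammaQ (2 * N) (2 * z * w)

/-- The second inhomogeneous term. -/
def termII (a : ℂ) (N : ℕ) (z w : ℂ) : ℂ :=
  4 * a * (z - a) ^ 3 * (w - a) ^ 2 * Complex.exp (2 * a ^ 2 - 2 * z * a - 2 * w * a)
    * ((2 * z * w) ^ (2 * N) / ((2 * N)! : ℂ)
      + (2 * (N : ℂ) + 1 - 2 * a * z)
        * (2 ^ (2 * N - 1) * truncExp N (a ^ 2) * (z * w) ^ (2 * N)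
          / (((2 * N)! : ℂ) * fSum N (a ^ 2))))

/-- The third inhomogeneous term. -/
def termIII (a : ℂ) (N : ℕ) (z w : ℂ) : ℂ :=
  (z - a) ^ 3 * Complex.exp (2 * a ^ 2 - 2 * z * a) * ((2 * (N : ℂ) + 1) / 2)
    * (((2 * (N : ℂ) + 3) * LHat (N + 1) w a - 2 * a ^ 2 * LHat N w a)
      / ((N ! : ℂ) * fSum N (a ^ 2))) * z ^ (2 * N)

/-- The fourth inhomogeneous term. -/
def termIV (a : ℂ) (N : ℕ) (z w : ℂ) : ℂ :=
  (z - a) ^ 3 * Complex.exp (2 * a ^ 2 - 2 * z * a) * (z * a)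
    * (((2 * (N : ℂ) + 1) * LHat (N + 1) w a - 2 * a ^ 2 * LHat N w a)
      / ((N ! : ℂ) * fSum N (a ^ 2))) * z ^ (2 * N)

end

open scoped Nat

noncomputable section

open Polynomial MeasureTheory

/-! In the Bargmann pairing of $L^2(e^{-2|z|^2}dA)$ multiplication by $z$ is adjoint to
$\frac12\partial$, so the skew-product equals the pairing of `bargmannOp a f` with `g`, a second
order operator with polynomial coefficients (`skewProduct_preWeight`). Conjugating $\mathfrak
D_{z,a}$ by $e^{-2az}$ and stripping $(z-a)^3$ gives $-2$ times the same operator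
(`twistOp_cube_mul`). The theorem is therefore a formula for `bargmannOp`, acting in $z$, on the
skew-kernel.

`bargmannOp` raises degrees by at most 2. For $f$ of degree below $2N$, the coefficients of its
image below $z^{2N}$ are skew-products of $f$ with monomials, and those of $z^{2N}$ and $z^{2N+1}$
are combinations of the top two coefficients of $f$ (`aeval_bargmannOp`). The skew-kernel reproduces
polynomials of degree below $2N$ (`aeval_eq_sum_of_isPlanarSOP`). Hence the monomials sum to a
truncated exponential of $2zw$, which is term I. The other two coefficients become values at $w$ of
polynomials $G$ and $F$ that represent the corresponding functionals in the skew-product.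

These representatives are explicit: $(X-a)^3F$ and $(X-a)^3G$ combine Wronskian-type expressions in
the GinSE kernel with a multiple of $(X-a)^2X^{2N}$. The first order equation of the GinSE kernel
gives their images under `twistOp`, and divisibility by $(X-a)^3$ follows from the exponents 0 and 3
of that operator at $a$ (`dvd_cube_of_twistOp`). The Wronskians yield terms III and IV, the monomial
correction term II. The polynomials $F$ have even degree and also serve as the even members of a
skew-orthogonal family, which gives existence. -/

/-! ### The two differential operators and their relation -/

/-- The second order operator representing the pre-overlap skew-product through the Bargmann
pairing. -/
def bargmannOp {K : Type*} [Field K] (a : K) (f : K[X]) : K[X] :=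
  -2 * C a * X ^ 2 * f + (4 + 2 * C a ^ 2) * X * f + X ^ 2 * derivative f
    - C (1 / 2) * ((4 + 2 * C a ^ 2) * derivative f + X * derivative (derivative f))
    + C (1 / 2) * C a * derivative (derivative f)

/-- The operator `∂ - 2a`, the conjugate of `∂` by `e^{-2az}`. -/
def twistDeriv {K : Type*} [Field K] (a : K) (f : K[X]) : K[X] := derivative f - 2 * C a * f

/-- The conjugate of `preOperator` by `e^{-2az}`. -/
def twistOp {K : Type*} [Field K] (a : K) (f : K[X]) : K[X] :=
  (X - C a) * twistDeriv a (twistDeriv a f) - (2 * (X - C a) ^ 2 + 2) * twistDeriv a f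
    - 2 * (X - C a) * f

lemma two_mul_C_half {K : Type*} [Field K] [CharZero K] : (2 : K[X]) * C (1 / 2) = 1 := by
  have : (2 : K[X]) = C 2 := (C_ofNat 2).symm
  rw [this, ← C_mul]; norm_num

/-- This identity is the reason for the cubic prefactor in the rescaled kernel: 3 is an exponent of
`twistOp` at $a$, and removing it leaves the operator of the skew-product. -/
lemma twistOp_cube_mul {K : Type*} [Field K] [CharZero K] (a : K) (f : K[X]) :
    twistOp a ((X - C a) ^ 3 * f) = -2 * (X - C a) ^ 3 * bargmannOp a f := by
  have h := two_mul_C_half (K := K)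
  simp only [twistOp, twistDeriv, bargmannOp, derivative_mul, derivative_sub, derivative_X,
    derivative_C, derivative_pow, derivative_add, derivative_ofNat, derivative_one]
  simp only [Nat.cast_ofNat, C_ofNat, Nat.add_one_sub_one, pow_one, derivative_zero]
  set H : K[X] := C (1 / 2)
  clear_value H
  linear_combination ((X - C a) ^ 3 * (-((4 + 2 * C a ^ 2) * derivative f
    + X * derivative (derivative f)) + C a * derivative (derivative f))) * h

/-- Near $a$ the leading part of `twistOp` is $(X-a)\partial^2-2\partial$, with indicial polynomial
$s(s-3)$. The hypothesis at $a$ excludes exponent 0, so $R$ vanishes to order 3. -/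
lemma dvd_cube_of_twistOp {K : Type*} [Field K] [CharZero K] (a : K) (R G : K[X]) (h0 : R.eval a = 0)
    (h : twistOp a R = (X - C a) ^ 3 * G) : (X - C a) ^ 3 ∣ R := by
  have h1 : (derivative R).eval a = 0 := by
    have := congrArg (eval a) h
    simp [twistOp, twistDeriv, h0] at this
    exact this
  have h2 : (derivative (derivative R)).eval a = 0 := by
    have := congrArg (fun p => eval a (derivative p)) h
    simp [twistOp, twistDeriv, h0, h1, derivative_pow] at this
    linear_combination -this
  by_cases hR : R = 0
  · simp [hR]
  · rw [← le_rootMultiplicity_iff hR]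
    apply lt_rootMultiplicity_of_isRoot_iterate_derivative hR
    intro m hm
    interval_cases m <;> simp [h0, h1, h2, IsRoot]

lemma twistOp_eq_cube {K : Type*} [Field K] [CharZero K] (a : K) (R G : K[X]) (h0 : R.eval a = 0)
    (h : twistOp a R = -2 * (X - C a) ^ 3 * G) :
    ∃ f, R = (X - C a) ^ 3 * f ∧ bargmannOp a f = G := by
  obtain ⟨f, hf⟩ := dvd_cube_of_twistOp a R (-2 * G) h0 (by rw [h]; ring)
  refine ⟨f, hf, ?_⟩
  rw [hf, twistOp_cube_mul] at h
  have h3 : (-2 * (X - C a) ^ 3 : K[X]) ≠ 0 :=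
    mul_ne_zero (by norm_num) (pow_ne_zero _ (X_sub_C_ne_zero a))
  exact mul_left_cancel₀ h3 h

lemma twistOp_add {K : Type*} [Field K] (a : K) (f g : K[X]) : twistOp a (f + g) = twistOp a f + twistOp a g := by
  simp only [twistOp, twistDeriv, derivative_add, derivative_sub, derivative_mul]; ring

lemma twistOp_C_mul {K : Type*} [Field K] (a c : K) (f : K[X]) : twistOp a (C c * f) = C c * twistOp a f := by
  simp only [twistOp, twistDeriv, derivative_sub, derivative_mul, derivative_C, zero_mul, zero_add]
  ring

lemma bargmannOp_add {K : Type*} [Field K] (a : K) (f g : K[X]) :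
    bargmannOp a (f + g) = bargmannOp a f + bargmannOp a g := by
  simp only [bargmannOp, derivative_add]; ring

lemma bargmannOp_C_mul {K : Type*} [Field K] (a c : K) (f : K[X]) :
    bargmannOp a (C c * f) = C c * bargmannOp a f := by
  simp only [bargmannOp, derivative_mul, derivative_C, zero_mul, zero_add]; ring

/-- If `g' = 2 X g + S`, then `twistOp` maps `(X - a)(∂ - 2a) g - g` to an expression in `S`. -/
lemma twistOp_wronskian {K : Type*} [Field K] (a : K) (g S : K[X]) (hg : derivative g = 2 * X * g + S) :
    twistOp a ((X - C a) * twistDeriv a g - g)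
      = (X - C a) ^ 2 * twistDeriv a (twistDeriv a S) - (X - C a) * twistDeriv a S := by
  -- After $g'$ is eliminated every term in $g$ cancels: for $S=0$ the conjugated function is a
  -- multiple of $e^{(X-a)^2}$, whose Wronskian with $X-a$ is annihilated by the operator.
  simp only [twistOp, twistDeriv, derivative_sub, derivative_mul, hg, derivative_X, derivative_C,
    derivative_add, derivative_ofNat]
  ring_nf
  simp

/-! ### The GinSE kernel and its first order equation -/

/-- The partial sum of the exponential series with `n` terms. -/
def expSum (n : ℕ) (x : ℝ) : ℝ := ∑ j ∈ Finset.range n, x ^ j / (j ! : ℝ)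

lemma expSum_succ (n : ℕ) (x : ℝ) : expSum (n + 1) x = expSum n x + x ^ n / (n ! : ℝ) := by
  simp [expSum, Finset.sum_range_succ]

/-- The coefficient `2^k / (2k-1)!! = 4^k k! / (2k)!`. -/
def oddCoeff (k : ℕ) : ℝ := 4 ^ k * (k ! : ℝ) / ((2 * k)! : ℝ)

lemma oddCoeff_pos (k : ℕ) : 0 < oddCoeff k := by unfold oddCoeff; positivity

lemma oddCoeff_succ (k : ℕ) : (2 * (k : ℝ) + 1) * oddCoeff (k + 1) = 2 * oddCoeff k := by
  have h : (2 * (k + 1))! = (2 * k + 2) * ((2 * k + 1) * (2 * k)!) := by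
    rw [show 2 * (k + 1) = 2 * k + 1 + 1 by ring, Nat.factorial_succ, Nat.factorial_succ]
  have h0 : ((2 * k)! : ℝ) ≠ 0 := by positivity
  have h1 : (2 * (k : ℝ) + 1) ≠ 0 := by positivity
  have h2 : (2 * (k : ℝ) + 2) ≠ 0 := by positivity
  unfold oddCoeff
  rw [h, Nat.factorial_succ]
  push_cast
  field_simp
  ring

lemma two_mul_pow_div_factorial (k : ℕ) (a : ℝ) :
    (2 * a) ^ (2 * k) / ((2 * k)! : ℝ) = oddCoeff k * (a ^ (2 * k) / (k ! : ℝ)) := by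
  have h0 : ((2 * k)! : ℝ) ≠ 0 := by positivity
  have h1 : (k ! : ℝ) ≠ 0 := by positivity
  unfold oddCoeff
  rw [mul_pow, pow_mul 2 2 k]
  field_simp
  norm_num
  ring

/-- The polynomial `∑_{l < n} X^{2l} / l!`. -/
def evenExp (n : ℕ) : ℝ[X] := ∑ l ∈ Finset.range n, C (1 / (l ! : ℝ)) * X ^ (2 * l)

lemma evenExp_succ (n : ℕ) : evenExp (n + 1) = evenExp n + C (1 / (n ! : ℝ)) * X ^ (2 * n) := by
  simp [evenExp, Finset.sum_range_succ]

lemma derivative_evenExp (n : ℕ) :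
    derivative (evenExp (n + 1))
      = 2 * X * evenExp (n + 1) - 2 * C (1 / (n ! : ℝ)) * X ^ (2 * n + 1) := by
  induction n with
  | zero => simp [evenExp]
  | succ n ih =>
    have h : C (1 / (n ! : ℝ)) = C (1 / ((n + 1)! : ℝ)) * ((n : ℝ[X]) + 1) := by
      rw [← C_eq_natCast, ← C_1, ← C_add, ← C_mul, Nat.factorial_succ]
      congr 1
      have : (n ! : ℝ) ≠ 0 := by positivity
      push_cast
      field_simp
    rw [evenExp_succ, derivative_add, ih, derivative_C_mul, derivative_X_pow, h]
    simp only [C_eq_natCast]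
    push_cast
    rw [show 2 * (n + 1) - 1 = 2 * n + 1 by omega]
    ring

/-- The GinSE skew-kernel `ϰ_k(X, a)` as a polynomial in its first argument. -/
def ginPoly (a : ℝ) (k : ℕ) : ℝ[X] :=
  ∑ j ∈ Finset.range k, C (oddCoeff (j + 1))
    * (C (expSum (j + 1) (a ^ 2)) * X ^ (2 * j + 1) - C (a ^ (2 * j + 1)) * evenExp (j + 1))

lemma ginPoly_succ (a : ℝ) (k : ℕ) : ginPoly a (k + 1) = ginPoly a k + C (oddCoeff (k + 1))
    * (C (expSum (k + 1) (a ^ 2)) * X ^ (2 * k + 1) - C (a ^ (2 * k + 1)) * evenExp (k + 1)) := by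
  simp [ginPoly, Finset.sum_range_succ]

/-- The polynomial `∑_{j < n} (2 a X)^j / j!`. -/
def expPoly (a : ℝ) (n : ℕ) : ℝ[X] :=
  ∑ j ∈ Finset.range n, C ((2 * a) ^ j / (j ! : ℝ)) * X ^ j

lemma expPoly_succ (a : ℝ) (n : ℕ) :
    expPoly a (n + 1) = expPoly a n + C ((2 * a) ^ n / (n ! : ℝ)) * X ^ n := by
  simp [expPoly, Finset.sum_range_succ]

/-- The full series $e^{2aX}$ is annihilated by $\partial-2a$, so only the truncation error
survives. -/
lemma twistDeriv_expPoly (a : ℝ) (n : ℕ) :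
    twistDeriv a (expPoly a (n + 1)) = - C ((2 * a) ^ (n + 1) / (n ! : ℝ)) * X ^ n := by
  induction n with
  | zero => simp [expPoly, twistDeriv, ← C_ofNat]
  | succ n ih =>
    have h : C ((2 * a) ^ (n + 1) / (n ! : ℝ))
        = C ((2 * a) ^ (n + 1) / ((n + 1)! : ℝ)) * ((n : ℝ[X]) + 1) := by
      rw [← C_eq_natCast, ← C_1, ← C_add, ← C_mul, Nat.factorial_succ]
      congr 1
      have : (n ! : ℝ) ≠ 0 := by positivity
      push_cast
      field_simp
    have h' : C ((2 * a) ^ (n + 1 + 1) / ((n + 1)! : ℝ))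
        = 2 * C a * C ((2 * a) ^ (n + 1) / ((n + 1)! : ℝ)) := by
      rw [← C_ofNat, ← C_mul, ← C_mul]
      congr 1
      ring
    unfold twistDeriv at *
    rw [expPoly_succ, derivative_add, derivative_C_mul, derivative_X_pow, h']
    rw [h] at ih
    simp only [C_eq_natCast, Nat.add_sub_cancel]
    push_cast
    linear_combination ih

/-- The inhomogeneity in the first order equation of the GinSE skew-kernel. -/
def ginSource (a : ℝ) (k : ℕ) : ℝ[X] :=
  2 * expPoly a (2 * k) - 2 * C (oddCoeff k * expSum k (a ^ 2)) * X ^ (2 * k)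

/-- Induction on $k$: the increment of `expSum` supplies the new even term of `expPoly`, the
truncation error of `evenExp` the new odd one, both through the recursion of `oddCoeff`. -/
lemma derivative_ginPoly (a : ℝ) (k : ℕ) :
    derivative (ginPoly a k) = 2 * X * ginPoly a k + ginSource a k := by
  induction k with
  | zero => simp [ginPoly, ginSource, expPoly, expSum]
  | succ k ih =>
    have h1 : C ((2 * a) ^ (2 * k) / ((2 * k)! : ℝ))
        = C (oddCoeff k) * C (a ^ (2 * k) / (k ! : ℝ)) := by
      rw [two_mul_pow_div_factorial, C_mul]
    have h2 : C ((2 * a) ^ (2 * k + 1) / ((2 * k + 1)! : ℝ))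
        = C (oddCoeff (k + 1)) * C (a ^ (2 * k + 1)) * C (1 / (k ! : ℝ)) := by
      rw [← C_mul, ← C_mul]
      congr 1
      have h := two_mul_pow_div_factorial k a
      have h3 := oddCoeff_succ k
      have h4 : (2 * (k : ℝ) + 1) ≠ 0 := by positivity
      have h5 : ((2 * k)! : ℝ) ≠ 0 := by positivity
      rw [Nat.factorial_succ, pow_succ]
      push_cast
      apply mul_left_cancel₀ h4
      calc _ = (2 * a) ^ (2 * k) / ((2 * k)! : ℝ) * (2 * a) := by field_simp
        _ = _ := by rw [h]; linear_combination (-(a ^ (2 * k) * a / (k ! : ℝ))) * h3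
    have h3 : C (oddCoeff k) * 2 = C (oddCoeff (k + 1)) * (2 * (k : ℝ[X]) + 1) := by
      rw [← C_ofNat, ← C_eq_natCast, ← C_1, ← C_mul, ← C_mul, ← C_add, ← C_mul]
      congr 1
      linear_combination -oddCoeff_succ k
    have h4 : C (expSum (k + 1) (a ^ 2))
        = C (expSum k (a ^ 2)) + C (a ^ (2 * k) / (k ! : ℝ)) := by
      rw [expSum_succ, C_add, pow_mul]
    simp only [ginSource] at ih ⊢
    rw [show 2 * (k + 1) = 2 * k + 1 + 1 by ring, expPoly_succ, expPoly_succ, ginPoly_succ,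
      derivative_add, ih, derivative_C_mul, derivative_sub, derivative_C_mul, derivative_C_mul,
      derivative_X_pow, derivative_evenExp, C_mul, C_mul, h1, h2, h4]
    simp only [C_eq_natCast, Nat.add_sub_cancel]
    push_cast
    linear_combination (-(C (expSum k (a ^ 2)) + C (a ^ (2 * k) / (k ! : ℝ))) * X ^ (2 * k)) * h3

/-- Only two powers of $X$ remain, which is what makes the images under `twistOp` below explicit. -/
lemma twistDeriv_ginSource (a : ℝ) (n : ℕ) :
    twistDeriv a (ginSource a (n + 1))
      = - 4 * C (oddCoeff (n + 1)) * C (a ^ (2 * (n + 1)) / ((n + 1)! : ℝ)) * ((n : ℝ[X]) + 1)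
          * X ^ (2 * n + 1)
        - 2 * C (oddCoeff (n + 1)) * C (expSum (n + 1) (a ^ 2))
          * (2 * ((n : ℝ[X]) + 1) * X ^ (2 * n + 1) - 2 * C a * X ^ (2 * n + 2)) := by
  have h := twistDeriv_expPoly a (2 * n + 1)
  have h1 : C ((2 * a) ^ (2 * n + 1 + 1) / ((2 * n + 1)! : ℝ))
      = 2 * C (oddCoeff (n + 1)) * C (a ^ (2 * (n + 1)) / ((n + 1)! : ℝ)) * ((n : ℝ[X]) + 1) := by
    rw [← C_ofNat, ← C_eq_natCast, ← C_1, ← C_mul, ← C_add, ← C_mul, ← C_mul]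
    congr 1
    have h2 := two_mul_pow_div_factorial (n + 1) a
    rw [show 2 * (n + 1) = 2 * n + 1 + 1 by ring] at h2 ⊢
    rw [Nat.factorial_succ] at h2
    rw [mul_assoc 2, ← h2]
    have h5 : ((2 * n + 1)! : ℝ) ≠ 0 := by positivity
    have h6 : (2 * (n : ℝ) + 1 + 1) ≠ 0 := by positivity
    push_cast
    field_simp
    ring
  rw [h1] at h
  simp only [twistDeriv, ginSource, derivative_sub, derivative_mul, derivative_ofNat, derivative_C,
    derivative_X_pow] at h ⊢
  rw [show 2 * (n + 1) = 2 * n + 1 + 1 by ring] at h ⊢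
  simp only [C_eq_natCast, Nat.add_sub_cancel, C_mul] at h ⊢
  push_cast at h ⊢
  linear_combination 2 * h

/-- The polynomial `(X - a) (∂ - 2a) ϰ_k(X, a) - ϰ_k(X, a)`, equal to
`(X - a)² e^{2aX} ∂ (e^{-2aX} ϰ_k(X, a) / (X - a))`. -/
def ginWronskian (a : ℝ) (k : ℕ) : ℝ[X] :=
  (X - C a) * twistDeriv a (ginPoly a k) - ginPoly a k

lemma twistOp_ginWronskian (a : ℝ) (k : ℕ) :
    twistOp a (ginWronskian a k)
      = (X - C a) ^ 2 * twistDeriv a (twistDeriv a (ginSource a k))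
        - (X - C a) * twistDeriv a (ginSource a k) :=
  twistOp_wronskian a _ _ (derivative_ginPoly a k)

lemma eval_ginPoly_self (a : ℝ) (k : ℕ) : (ginPoly a k).eval a = 0 := by
  unfold ginPoly
  rw [eval_finsetSum]
  apply Finset.sum_eq_zero
  intro j _
  have : (evenExp (j + 1)).eval a = expSum (j + 1) (a ^ 2) := by
    simp only [evenExp, expSum, eval_finsetSum, eval_mul, eval_C, eval_pow, eval_X]
    refine Finset.sum_congr rfl fun l _ => ?_
    rw [pow_mul]; ring
  simp [this]
  right
  ring

lemma eval_ginWronskian_self (a : ℝ) (k : ℕ) : (ginWronskian a k).eval a = 0 := by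
  simp [ginWronskian, eval_ginPoly_self]

/-! ### The explicit numerators and their images -/

/-- The sum `f_k(x) = ∑_{j ≤ k} (k + 1 - j) x^j / j!`, shifted so that `fReal (k + 1) = f_k`. -/
def fReal (k : ℕ) (x : ℝ) : ℝ := ∑ j ∈ Finset.range k, ((k : ℝ) - j) * (x ^ j / (j ! : ℝ))

lemma fReal_succ (k : ℕ) (x : ℝ) : fReal (k + 1) x = fReal k x + expSum (k + 1) x := by
  simp only [fReal, expSum, Finset.sum_range_succ]
  have : ∑ j ∈ Finset.range k, (((k + 1 : ℕ) : ℝ) - j) * (x ^ j / (j ! : ℝ))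
      = ∑ j ∈ Finset.range k, ((k : ℝ) - j) * (x ^ j / (j ! : ℝ))
        + ∑ j ∈ Finset.range k, (x ^ j / (j ! : ℝ)) := by
    rw [← Finset.sum_add_distrib]
    refine Finset.sum_congr rfl fun j _ => ?_
    push_cast; ring
  rw [this]
  push_cast; ring

lemma fReal_pos (k : ℕ) (x : ℝ) (hx : 0 ≤ x) : 0 < fReal (k + 1) x := by
  unfold fReal
  apply Finset.sum_pos'
  · intro j hj
    have : (j : ℝ) ≤ ((k + 1 : ℕ) : ℝ) := by
      exact_mod_cast (Finset.mem_range.mp hj).le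
    have := sub_nonneg.mpr this
    positivity
  · exact ⟨0, by simp, by simp; positivity⟩

lemma fReal_eq (k : ℕ) (x : ℝ) :
    fReal (k + 1) x = ((k : ℝ) + 1) * expSum (k + 1) x - x * expSum k x := by
  induction k with
  | zero => simp [fReal, expSum]
  | succ k ih =>
    rw [fReal_succ, ih, expSum_succ (k + 1), expSum_succ k, Nat.factorial_succ]
    have h1 : (k : ℝ) + 1 ≠ 0 := by positivity
    have h2 : (k ! : ℝ) ≠ 0 := by positivity
    push_cast
    field_simp
    ring

lemma twistDeriv_mul (a : ℝ) (p : ℝ[X]) (n : ℕ) :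
    twistDeriv a (p * X ^ (n + 1))
      = (X * derivative p + ((n : ℝ[X]) + 1) * p - 2 * C a * X * p) * X ^ n := by
  simp only [twistDeriv, derivative_mul, derivative_X_pow_succ, C_add, C_eq_natCast, C_1]
  ring

lemma twistOp_square_mul_X_pow (a : ℝ) (n : ℕ) :
    twistOp a ((X - C a) ^ 2 * X ^ (2 * n + 2)) = X ^ (2 * n) * (X - C a)
      * (2 * X ^ 2 + 4 * (X - C a) * ((2 * (n : ℝ[X]) + 2) * X)
          + (X - C a) ^ 2 * ((2 * (n : ℝ[X]) + 2) * (2 * (n : ℝ[X]) + 1))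
          - 4 * C a * (X - C a) * (2 * X ^ 2 + (X - C a) * ((2 * (n : ℝ[X]) + 2) * X))
          + 4 * C a ^ 2 * (X - C a) ^ 2 * X ^ 2
          - (2 * (X - C a) ^ 2 + 2) * (2 * X ^ 2 + (X - C a) * ((2 * (n : ℝ[X]) + 2) * X))
          + 2 * C a * (2 * (X - C a) ^ 2 + 2) * (X - C a) * X ^ 2
          - 2 * (X - C a) ^ 2 * X ^ 2) := by
  have h1 : derivative ((X : ℝ[X]) ^ (2 * n + 2)) = (2 * (n : ℝ[X]) + 2) * X ^ (2 * n + 1) := by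
    rw [derivative_X_pow_succ]; simp only [C_add, C_eq_natCast, C_1]; push_cast; ring
  have h2 : derivative ((X : ℝ[X]) ^ (2 * n + 1)) = (2 * (n : ℝ[X]) + 1) * X ^ (2 * n) := by
    rw [derivative_X_pow_succ]; simp only [C_add, C_eq_natCast, C_1]; push_cast; ring
  simp only [twistOp, twistDeriv, derivative_sub, derivative_mul, derivative_ofNat, derivative_C,
    h1, h2, derivative_X_sub_C_sq, derivative_X, derivative_add, derivative_natCast, C_ofNat]
  ring

/-- Up to the factor `4 N! f_N(a²) (X - a)³`, with `N = n + 1`, the coefficient of `z^{2N-1}` in the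
pre-overlap skew-kernel. -/
def topNumerator (a : ℝ) (n : ℕ) : ℝ[X] :=
  C (4 * a * oddCoeff (n + 1) * expSum (n + 2) (a ^ 2)) * ((X - C a) ^ 2 * X ^ (2 * n + 2))
    + C (2 * (n : ℝ) + 3) * ginWronskian a (n + 2) + C (-(2 * a ^ 2)) * ginWronskian a (n + 1)

/-- A multiple of `(X - a)³` times the coefficient of `z^{2N}` in the image of the pre-overlap
skew-kernel under `bargmannOp`, with `N = n + 1`. -/
def subNumerator (a : ℝ) (n : ℕ) : ℝ[X] :=
  C (-(4 * a * oddCoeff (n + 1)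
      * (2 * fReal (n + 2) (a ^ 2) + (2 * (n : ℝ) + 3) * expSum (n + 2) (a ^ 2))))
      * ((X - C a) ^ 2 * X ^ (2 * n + 2))
    + C (-((2 * (n : ℝ) + 3) * (2 * n + 5))) * ginWronskian a (n + 2)
    + C ((2 * (n : ℝ) + 3) * (2 * a ^ 2)) * ginWronskian a (n + 1)

/-- All factorials and partial sums are reduced to three parameters, so that the two identities for
the numerators become polynomial identities that `ring` can decide. -/
lemma exists_twistOp_ginWronskian (a : ℝ) (n : ℕ) : ∃ h e y : ℝ,
    oddCoeff (n + 1) = (2 * (n : ℝ) + 3) * h ∧ expSum (n + 2) (a ^ 2) = e ∧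
    fReal (n + 2) (a ^ 2) = ((n : ℝ) + 2) * e - a ^ 2 * (e - y) ∧
    fReal (n + 1) (a ^ 2) = ((n : ℝ) + 1) * e - a ^ 2 * (e - y) ∧
    twistOp a (ginWronskian a (n + 1)) = (X - C a) * (C h * (2 * (n : ℝ[X]) + 3))
      * ((X - C a) * (-4 * C y * ((n : ℝ[X]) + 1) * (2 * (n : ℝ[X]) + 1 - 2 * C a * X)
          - 2 * (C e - C y) * (2 * ((n : ℝ[X]) + 1) * (2 * (n : ℝ[X]) + 1 - 2 * C a * X)
              - 2 * C a * X * (2 * (n : ℝ[X]) + 2 - 2 * C a * X)))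
        - X * (-4 * C y * ((n : ℝ[X]) + 1)
          - 2 * (C e - C y) * (2 * ((n : ℝ[X]) + 1) - 2 * C a * X))) * X ^ (2 * n) ∧
    twistOp a (ginWronskian a (n + 2)) = (X - C a) * (2 * C h)
      * ((X - C a) * (-4 * (C a ^ 2 * C y) * (2 * (n : ℝ[X]) + 3 - 2 * C a * X)
          - 2 * C e * (2 * ((n : ℝ[X]) + 2) * (2 * (n : ℝ[X]) + 3 - 2 * C a * X)
              - 2 * C a * X * (2 * (n : ℝ[X]) + 4 - 2 * C a * X)))
        - X * (-4 * (C a ^ 2 * C y)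
          - 2 * C e * (2 * ((n : ℝ[X]) + 2) - 2 * C a * X))) * X ^ (2 * n + 2) := by
  have hd := oddCoeff_succ (n + 1)
  push_cast at hd
  have he := expSum_succ (n + 1) (a ^ 2)
  rw [← pow_mul] at he
  -- With $N=n+1$, `e` is $e_N(a^2)$ and `y` its last term, so `e - y` is $e_{N-1}(a^2)$. The half
  -- in `h` clears the denominator of the `oddCoeff` recursion.
  refine ⟨oddCoeff (n + 2) / 2, expSum (n + 2) (a ^ 2), a ^ (2 * (n + 1)) / ((n + 1)! : ℝ),
    by linear_combination -hd / 2, rfl, ?_, ?_, ?_, ?_⟩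
  · rw [fReal_eq, he]
    push_cast; ring
  · have := fReal_succ (n + 1) (a ^ 2)
    rw [fReal_eq] at this
    rw [he] at this ⊢
    push_cast at this
    linear_combination -this
  · have h1 : C (oddCoeff (n + 1)) = C (oddCoeff (n + 2) / 2) * (2 * (n : ℝ[X]) + 3) := by
      rw [← C_ofNat, ← C_ofNat, ← C_eq_natCast, ← C_mul, ← C_add, ← C_mul]
      congr 1
      linear_combination -hd / 2
    have h2 : C (expSum (n + 1) (a ^ 2))
        = C (expSum (n + 2) (a ^ 2)) - C (a ^ (2 * (n + 1)) / ((n + 1)! : ℝ)) := by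
      rw [← C_sub, he]; congr 1; ring
    have h3 := twistDeriv_ginSource a n
    rw [h1, h2] at h3
    have h4 : twistDeriv a (ginSource a (n + 1)) = (C (oddCoeff (n + 2) / 2)
        * (2 * (n : ℝ[X]) + 3) * (-4 * C (a ^ (2 * (n + 1)) / ((n + 1)! : ℝ)) * ((n : ℝ[X]) + 1)
          - 2 * (C (expSum (n + 2) (a ^ 2)) - C (a ^ (2 * (n + 1)) / ((n + 1)! : ℝ)))
            * (2 * ((n : ℝ[X]) + 1) - 2 * C a * X))) * X ^ (2 * n + 1) := by
      rw [h3]; ring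
    rw [twistOp_ginWronskian, h4, twistDeriv_mul]
    simp only [derivative_sub, derivative_mul, derivative_ofNat, derivative_C, derivative_neg,
      derivative_X, derivative_add, derivative_natCast, derivative_one]
    push_cast
    ring
  · have h1 : C (oddCoeff (n + 2)) = 2 * C (oddCoeff (n + 2) / 2) := by
      rw [← C_ofNat, ← C_mul]
      congr 1
      ring
    have h2 : C (a ^ (2 * (n + 1 + 1)) / ((n + 1 + 1)! : ℝ)) * ((n : ℝ[X]) + 2)
        = C a ^ 2 * C (a ^ (2 * (n + 1)) / ((n + 1)! : ℝ)) := by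
      rw [← C_ofNat, ← C_eq_natCast, ← C_add, ← C_pow, ← C_mul, ← C_mul]
      congr 1
      rw [Nat.factorial_succ (n + 1)]
      have h5 : ((n + 1)! : ℝ) ≠ 0 := by positivity
      have h6 : ((n : ℝ) + 1 + 1) ≠ 0 := by positivity
      push_cast
      field_simp
      ring
    have h3 := twistDeriv_ginSource a (n + 1)
    rw [h1] at h3
    push_cast at h3
    have h4 : twistDeriv a (ginSource a (n + 2)) = (2 * C (oddCoeff (n + 2) / 2)
        * (-4 * (C a ^ 2 * C (a ^ (2 * (n + 1)) / ((n + 1)! : ℝ)))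
          - 2 * C (expSum (n + 2) (a ^ 2))
            * (2 * ((n : ℝ[X]) + 2) - 2 * C a * X))) * X ^ (2 * n + 2 + 1) := by
      rw [h3]
      linear_combination (-8 * C (oddCoeff (n + 2) / 2) * X ^ (2 * n + 2 + 1)) * h2
    rw [twistOp_ginWronskian, h4, twistDeriv_mul]
    simp only [derivative_sub, derivative_mul, derivative_ofNat, derivative_C, derivative_neg,
      derivative_X, derivative_add, derivative_natCast, derivative_pow]
    push_cast
    ring

/-- Each Wronskian alone gives an image with only a visible factor $X-a$; the weights in
`topNumerator` produce the full cube. -/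
lemma twistOp_topNumerator (a : ℝ) (n : ℕ) :
    twistOp a (topNumerator a n) = -2 * (X - C a) ^ 3
      * (C (8 * oddCoeff (n + 1)) * X ^ (2 * n + 1)
      * (C (((n : ℝ) + 1) * fReal (n + 2) (a ^ 2)) - C (a * fReal (n + 1) (a ^ 2)) * X)) := by
  obtain ⟨h, e, y, h1, h2, h3, h4, h5, h6⟩ := exists_twistOp_ginWronskian a n
  rw [topNumerator, twistOp_add, twistOp_add, twistOp_C_mul, twistOp_C_mul, twistOp_C_mul,
    h5, h6, twistOp_square_mul_X_pow, h1, h2, h3, h4]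
  simp only [C_mul, C_add, C_sub, C_pow, C_eq_natCast, C_ofNat, C_1, C_neg]
  ring

lemma twistOp_subNumerator (a : ℝ) (n : ℕ) :
    twistOp a (subNumerator a n) = -2 * (X - C a) ^ 3
      * (C (-(4 * oddCoeff (n + 1))) * X ^ (2 * n)
      * (C (-(2 * a * (n + 1) * (2 * n + 1) * fReal (n + 2) (a ^ 2)))
        + C (2 * (n + 1) * (2 * n + 5 + 2 * a ^ 2) * fReal (n + 2) (a ^ 2)) * X
        - C (4 * a ^ 2 * fReal (n + 1) (a ^ 2)) * X ^ 3)) := by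
  obtain ⟨h, e, y, h1, h2, h3, h4, h5, h6⟩ := exists_twistOp_ginWronskian a n
  rw [subNumerator, twistOp_add, twistOp_add, twistOp_C_mul, twistOp_C_mul, twistOp_C_mul,
    h5, h6, twistOp_square_mul_X_pow, h1, h2, h3, h4]
  simp only [C_mul, C_add, C_sub, C_pow, C_eq_natCast, C_ofNat, C_1, C_neg]
  ring

/-! ### Degrees of the numerators and their quotients -/

lemma coeff_evenExp_of_le (n m : ℕ) (h : 2 * n ≤ m) : (evenExp n).coeff m = 0 := by
  unfold evenExp
  rw [finsetSum_coeff]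
  apply Finset.sum_eq_zero
  intro l hl
  have := Finset.mem_range.mp hl
  rw [coeff_C_mul, coeff_X_pow, if_neg (by omega), mul_zero]

lemma coeff_ginPoly_of_le (a : ℝ) (k m : ℕ) (h : 2 * k ≤ m) : (ginPoly a k).coeff m = 0 := by
  unfold ginPoly
  rw [finsetSum_coeff]
  apply Finset.sum_eq_zero
  intro j hj
  have := Finset.mem_range.mp hj
  rw [coeff_C_mul, coeff_sub, coeff_C_mul, coeff_C_mul, coeff_X_pow, if_neg (by omega),
    coeff_evenExp_of_le _ _ (by omega)]
  ring

lemma coeff_ginPoly_odd (a : ℝ) (k : ℕ) :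
    (ginPoly a (k + 1)).coeff (2 * k + 1) = oddCoeff (k + 1) * expSum (k + 1) (a ^ 2) := by
  rw [ginPoly_succ, coeff_add, coeff_ginPoly_of_le _ _ _ (by omega), evenExp_succ, coeff_C_mul,
    coeff_sub, coeff_C_mul, coeff_C_mul, coeff_add, coeff_evenExp_of_le _ _ (by omega),
    coeff_C_mul, coeff_X_pow, coeff_X_pow, if_pos rfl, if_neg (by omega)]
  ring

lemma coeff_ginPoly_even (a : ℝ) (k : ℕ) :
    (ginPoly a (k + 1)).coeff (2 * k) = -(oddCoeff (k + 1) * (a ^ (2 * k + 1) / (k ! : ℝ))) := by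
  rw [ginPoly_succ, coeff_add, coeff_ginPoly_of_le _ _ _ (by omega), evenExp_succ, coeff_C_mul,
    coeff_sub, coeff_C_mul, coeff_C_mul, coeff_add, coeff_evenExp_of_le _ _ (by omega),
    coeff_C_mul, coeff_X_pow, coeff_X_pow, if_neg (by omega), if_pos rfl]
  ring

lemma coeff_ginWronskian_succ (a : ℝ) (k m : ℕ) :
    (ginWronskian a k).coeff (m + 1)
      = ((m : ℝ) + 2 * a ^ 2) * (ginPoly a k).coeff (m + 1) - 2 * a * (ginPoly a k).coeff m
        - a * (m + 2) * (ginPoly a k).coeff (m + 2) := by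
  rw [ginWronskian, twistDeriv, ← C_ofNat, mul_assoc]
  simp only [sub_mul, coeff_sub, coeff_X_mul, coeff_C_mul, coeff_derivative]
  push_cast
  ring

lemma square_mul_X_pow (a : ℝ) (k : ℕ) : (X - C a) ^ 2 * X ^ k
    = X ^ (k + 2) + C (-(2 * a)) * X ^ (k + 1) + C (a ^ 2) * X ^ k := by
  simp only [C_mul, C_pow, C_neg, C_ofNat]
  ring

lemma coeff_topNumerator_of_lt (a : ℝ) (n m : ℕ) (h : 2 * n + 3 < m) :
    (topNumerator a n).coeff m = 0 := by
  obtain ⟨m, rfl⟩ : ∃ j, m = j + 1 := ⟨m - 1, by omega⟩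
  simp only [topNumerator, square_mul_X_pow, coeff_add, coeff_C_mul, coeff_ginWronskian_succ,
    coeff_X_pow]
  rw [coeff_ginPoly_of_le a (n + 2) (m + 1) (by omega), coeff_ginPoly_of_le a (n + 2) (m + 2)
    (by omega), coeff_ginPoly_of_le a (n + 1) (m + 1) (by omega), coeff_ginPoly_of_le a (n + 1)
    (m + 2) (by omega), coeff_ginPoly_of_le a (n + 1) m (by omega),
    if_neg (show ¬ m + 1 = 2 * n + 2 + 1 by omega), if_neg (show ¬ m + 1 = 2 * n + 2 by omega)]
  -- In degree $2n+4$ the leading term of the larger Wronskian cancels against that of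
  -- $(X-a)^2X^{2n+2}$. This drops the degree of the quotient to the even number $2n$.
  rcases eq_or_ne m (2 * n + 3) with rfl | hm
  · have h2 := coeff_ginPoly_odd a (n + 1)
    rw [show 2 * (n + 1) + 1 = 2 * n + 3 by ring] at h2
    have hd := oddCoeff_succ (n + 1)
    push_cast at hd
    rw [h2, if_pos (by omega)]
    linear_combination (-2 * a * expSum (n + 2) (a ^ 2)) * hd
  · rw [if_neg (by omega), coeff_ginPoly_of_le a (n + 2) m (by omega)]
    ring

lemma coeff_topNumerator (a : ℝ) (n : ℕ) :
    (topNumerator a n).coeff (2 * n + 3) = 4 * oddCoeff (n + 1) * fReal (n + 1) (a ^ 2) := by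
  have h2 := coeff_ginPoly_odd a (n + 1)
  have h3 := coeff_ginPoly_even a (n + 1)
  rw [show 2 * (n + 1) + 1 = 2 * n + 2 + 1 by ring] at h2 h3
  rw [show 2 * (n + 1) = 2 * n + 2 by ring] at h3
  have hd := oddCoeff_succ (n + 1)
  have hf := fReal_succ (n + 1) (a ^ 2)
  have hf2 := fReal_eq (n + 1) (a ^ 2)
  have he := expSum_succ (n + 1) (a ^ 2)
  push_cast at hd hf2
  have hp : a ^ (2 * n + 2 + 1) = a * (a ^ 2) ^ (n + 1) := by rw [← pow_mul]; ring
  rw [hp] at h3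
  rw [show 2 * n + 3 = 2 * n + 2 + 1 by ring]
  simp only [topNumerator, square_mul_X_pow, coeff_add, coeff_C_mul, coeff_ginWronskian_succ,
    coeff_X_pow]
  rw [h2, h3, coeff_ginPoly_of_le a (n + 2) (2 * n + 2 + 2) (by omega),
    coeff_ginPoly_of_le a (n + 1) (2 * n + 2) (by omega),
    coeff_ginPoly_of_le a (n + 1) (2 * n + 2 + 1) (by omega),
    coeff_ginPoly_of_le a (n + 1) (2 * n + 2 + 2) (by omega),
    if_neg (show ¬ 2 * n + 2 + 1 = 2 * n + 2 + 2 by omega), if_pos trivial,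
    if_neg (show ¬ 2 * n + 2 + 1 = 2 * n + 2 by omega)]
  rw [show n + 1 + 1 = n + 2 by ring] at *
  have hf3 : fReal (n + 1) (a ^ 2) = ((n : ℝ) + 1) * expSum (n + 2) (a ^ 2)
      - a ^ 2 * (expSum (n + 2) (a ^ 2) - (a ^ 2) ^ (n + 1) / ((n + 1)! : ℝ)) := by
    linear_combination hf2 - hf + a ^ 2 * he
  rw [hf3]
  push_cast
  linear_combination ((2 * n + 2 + 2 * a ^ 2) * expSum (n + 2) (a ^ 2)
    + 2 * a ^ 2 * ((a ^ 2) ^ (n + 1) / ((n + 1)! : ℝ))) * hd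

lemma coeff_subNumerator_of_lt (a : ℝ) (n m : ℕ) (h : 2 * n + 4 < m) :
    (subNumerator a n).coeff m = 0 := by
  obtain ⟨m, rfl⟩ : ∃ j, m = j + 1 := ⟨m - 1, by omega⟩
  simp only [subNumerator, square_mul_X_pow, coeff_add, coeff_C_mul, coeff_ginWronskian_succ,
    coeff_X_pow]
  rw [coeff_ginPoly_of_le a (n + 2) (m + 1) (by omega), coeff_ginPoly_of_le a (n + 2) (m + 2)
    (by omega), coeff_ginPoly_of_le a (n + 1) (m + 1) (by omega), coeff_ginPoly_of_le a (n + 1)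
    (m + 2) (by omega), coeff_ginPoly_of_le a (n + 1) m (by omega), coeff_ginPoly_of_le a (n + 2)
    m (by omega), if_neg (by omega), if_neg (by omega), if_neg (by omega)]
  ring

/-- The quotient of `topNumerator` by `(X - a)³` and its degree. -/
lemma exists_topPoly (a : ℝ) (n : ℕ) : ∃ F : ℝ[X], topNumerator a n = (X - C a) ^ 3 * F ∧
    F.natDegree = 2 * n ∧ F ≠ 0 ∧
    bargmannOp a F = C (8 * oddCoeff (n + 1)) * X ^ (2 * n + 1)
      * (C (((n : ℝ) + 1) * fReal (n + 2) (a ^ 2)) - C (a * fReal (n + 1) (a ^ 2)) * X) := by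
  obtain ⟨F, hF, hT⟩ := twistOp_eq_cube a _ _
    (by simp [topNumerator, eval_ginWronskian_self]) (twistOp_topNumerator a n)
  have hpos : 4 * oddCoeff (n + 1) * fReal (n + 1) (a ^ 2) ≠ 0 := by
    have := oddCoeff_pos (n + 1)
    have := fReal_pos n (a ^ 2) (sq_nonneg a)
    positivity
  have hdeg : (topNumerator a n).natDegree = 2 * n + 3 := by
    apply natDegree_eq_of_le_of_coeff_ne_zero
    · exact natDegree_le_iff_coeff_eq_zero.mpr fun m hm => coeff_topNumerator_of_lt a n m hm
    · rw [coeff_topNumerator]; exact hpos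
  have hF0 : F ≠ 0 := by
    rintro rfl
    rw [hF] at hdeg
    simp at hdeg
  refine ⟨F, hF, ?_, hF0, hT⟩
  rw [hF, Monic.natDegree_mul' ((monic_X_sub_C a).pow 3) hF0, natDegree_pow,
    natDegree_X_sub_C] at hdeg
  omega

/-- The quotient of `subNumerator` by `(X - a)³` and a bound for its degree. -/
lemma exists_subPoly (a : ℝ) (n : ℕ) : ∃ G : ℝ[X], subNumerator a n = (X - C a) ^ 3 * G ∧
    G.natDegree < 2 * n + 2 ∧
    bargmannOp a G = C (-(4 * oddCoeff (n + 1))) * X ^ (2 * n)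
      * (C (-(2 * a * (n + 1) * (2 * n + 1) * fReal (n + 2) (a ^ 2)))
        + C (2 * (n + 1) * (2 * n + 5 + 2 * a ^ 2) * fReal (n + 2) (a ^ 2)) * X
        - C (4 * a ^ 2 * fReal (n + 1) (a ^ 2)) * X ^ 3) := by
  obtain ⟨G, hG, hT⟩ := twistOp_eq_cube a _ _
    (by simp [subNumerator, eval_ginWronskian_self]) (twistOp_subNumerator a n)
  refine ⟨G, hG, ?_, hT⟩
  rcases eq_or_ne G 0 with rfl | hG0
  · simp
  · have hdeg : (subNumerator a n).natDegree ≤ 2 * n + 4 :=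
      natDegree_le_iff_coeff_eq_zero.mpr fun m hm => coeff_subNumerator_of_lt a n m hm
    rw [hG, Monic.natDegree_mul' ((monic_X_sub_C a).pow 3) hG0, natDegree_pow,
      natDegree_X_sub_C] at hdeg
    omega

/-! ### Gaussian moments and the Bargmann pairing -/

lemma integrable_norm_pow_mul_exp (n : ℕ) :
    Integrable (fun z : ℂ => ‖z‖ ^ n * Real.exp (-2 * ‖z‖ ^ 2)) := by
  -- Half of the Gaussian decay absorbs the power, by $t^n\le n!\,e^t$ at $t=|z|^2$; the other half
  -- is the integrable majorant.
  have h := (GaussianFourier.integrable_cexp_neg_mul_sq_norm_add (V := ℂ) (b := 1) (by simp) 0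
    0).norm.const_mul (1 + (n ! : ℝ))
  refine h.mono' (by fun_prop) (Filter.Eventually.of_forall fun z => ?_)
  have h0 : 0 ≤ ‖z‖ := norm_nonneg z
  have h1 : ‖Complex.exp (-(1 : ℂ) * (‖z‖ : ℂ) ^ 2 + 0 * ((inner ℝ (0 : ℂ) z : ℝ) : ℂ))‖
      = Real.exp (-‖z‖ ^ 2) := by
    rw [Complex.norm_exp]
    congr 1
    simp [← Complex.ofReal_pow]
  rw [h1, Real.norm_of_nonneg (by positivity)]
  have h2 : (‖z‖ ^ 2) ^ n ≤ n ! * Real.exp (‖z‖ ^ 2) := by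
    have := Real.pow_div_factorial_le_exp (‖z‖ ^ 2) (by positivity) n
    rwa [div_le_iff₀ (by positivity), mul_comm] at this
  have h3 : ‖z‖ ^ n ≤ 1 + (‖z‖ ^ 2) ^ n := by
    rw [← pow_mul, mul_comm 2, pow_mul]
    nlinarith [sq_nonneg (‖z‖ ^ n - 1), pow_nonneg h0 n]
  have h4 : 1 ≤ Real.exp (‖z‖ ^ 2) := Real.one_le_exp (by positivity)
  have h5 : Real.exp (-2 * ‖z‖ ^ 2) = Real.exp (-‖z‖ ^ 2) * Real.exp (-‖z‖ ^ 2) := by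
    rw [← Real.exp_add]; congr 1; ring
  have h6 : Real.exp (‖z‖ ^ 2) * Real.exp (-‖z‖ ^ 2) = 1 := by
    rw [← Real.exp_add]; simp
  calc ‖z‖ ^ n * Real.exp (-2 * ‖z‖ ^ 2)
      ≤ ((1 + n !) * Real.exp (‖z‖ ^ 2)) * Real.exp (-2 * ‖z‖ ^ 2) := by
        gcongr
        linarith
    _ = (1 + n !) * Real.exp (-‖z‖ ^ 2) := by
        rw [h5]; linear_combination ((1 + (n ! : ℝ)) * Real.exp (-‖z‖ ^ 2)) * h6

lemma integrable_pow_mul_conj_pow (i j : ℕ) :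
    Integrable (fun z : ℂ => z ^ i * starRingEnd ℂ z ^ j * (Real.exp (-2 * ‖z‖ ^ 2) : ℂ)) := by
  refine (integrable_norm_pow_mul_exp (i + j)).mono' ?_ (Filter.Eventually.of_forall fun z => ?_)
  · exact (by fun_prop : Continuous fun z : ℂ =>
      z ^ i * starRingEnd ℂ z ^ j * (Real.exp (-2 * ‖z‖ ^ 2) : ℂ)).aestronglyMeasurable
  · simp only [norm_mul, norm_pow, RCLike.norm_conj, Complex.norm_real, Real.norm_eq_abs,
      Real.abs_exp, pow_add]
    exact le_rfl

lemma integral_pow_mul_conj_pow_self (i : ℕ) :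
    ∫ z : ℂ, z ^ i * starRingEnd ℂ z ^ i * (Real.exp (-2 * ‖z‖ ^ 2) : ℂ)
      = ((Real.pi * ((i ! : ℝ) / 2 ^ (i + 1)) : ℝ) : ℂ) := by
  have h := Complex.integral_rpow_mul_exp_neg_mul_rpow (p := 2) (q := (2 * i : ℕ)) (b := 2)
    (by norm_num) (by have : (0 : ℝ) ≤ (2 * i : ℕ) := by positivity
                      linarith) (by norm_num)
  have h1 : (((2 * i : ℕ) : ℝ) + 2) / 2 = (i : ℝ) + 1 := by push_cast; ring
  have h2 : (2 : ℝ) ^ (-(((2 * i : ℕ) : ℝ) + 2) / 2) = 1 / 2 ^ (i + 1) := by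
    rw [show -(((2 * i : ℕ) : ℝ) + 2) / 2 = -((i + 1 : ℕ) : ℝ) by push_cast; ring,
      Real.rpow_neg (by norm_num), Real.rpow_natCast, one_div]
  rw [h1, h2, Real.Gamma_nat_eq_factorial] at h
  have h3 : ∀ z : ℂ, z ^ i * starRingEnd ℂ z ^ i * (Real.exp (-2 * ‖z‖ ^ 2) : ℂ)
      = ((‖z‖ ^ ((2 * i : ℕ) : ℝ) * Real.exp (-2 * ‖z‖ ^ (2 : ℝ)) : ℝ) : ℂ) := by
    intro z
    rw [← mul_pow, Complex.mul_conj, Complex.normSq_eq_norm_sq, Real.rpow_natCast, pow_mul,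
      Real.rpow_two]
    push_cast
    ring
  simp_rw [h3]
  rw [integral_complex_ofReal, h]
  congr 1
  ring

lemma integral_pow_mul_conj_pow_of_ne (i j : ℕ) (hij : i ≠ j) :
    ∫ z : ℂ, z ^ i * starRingEnd ℂ z ^ j * (Real.exp (-2 * ‖z‖ ^ 2) : ℂ) = 0 := by
  -- One rotation, by one radian, suffices: if it fixed $z^i\bar z^j$ with $i\ne j$, then $i-j$
  -- would be a nonzero integer multiple of $2\pi$, against the irrationality of $\pi$.
  set c : Circle := Circle.exp 1
  have hmp := (rotation c).measurePreserving
  have h := hmp.integral_comp (rotation c).toHomeomorph.measurableEmbedding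
    (fun z : ℂ => z ^ i * starRingEnd ℂ z ^ j * (Real.exp (-2 * ‖z‖ ^ 2) : ℂ))
  set J := ∫ z : ℂ, z ^ i * starRingEnd ℂ z ^ j * (Real.exp (-2 * ‖z‖ ^ 2) : ℂ)
  have h1 : ∀ z : ℂ, (rotation c z) ^ i * starRingEnd ℂ (rotation c z) ^ j
        * (Real.exp (-2 * ‖rotation c z‖ ^ 2) : ℂ)
      = ((c : ℂ) ^ i * starRingEnd ℂ (c : ℂ) ^ j)
        * (z ^ i * starRingEnd ℂ z ^ j * (Real.exp (-2 * ‖z‖ ^ 2) : ℂ)) := by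
    intro z
    rw [LinearIsometryEquiv.norm_map, rotation_apply, map_mul]
    ring
  simp_rw [h1] at h
  rw [integral_const_mul] at h
  by_contra hJ
  have h2 : (c : ℂ) ^ i * starRingEnd ℂ (c : ℂ) ^ j = 1 := by
    apply mul_right_cancel₀ hJ
    rw [h, one_mul]
  rw [Circle.coe_exp, ← Complex.exp_conj, ← Complex.exp_nat_mul, ← Complex.exp_nat_mul,
    ← Complex.exp_add, Complex.exp_eq_one_iff] at h2
  obtain ⟨n, hn⟩ := h2
  have h3 : ((i : ℝ) - j) = n * (2 * Real.pi) := by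
    have := congrArg Complex.im hn
    simp at this
    linarith
  have hn0 : n ≠ 0 := by
    rintro rfl
    apply hij
    have : (i : ℝ) = j := by simpa [sub_eq_zero] using h3
    exact_mod_cast this
  apply irrational_pi.ne_rat (((i : ℚ) - j) / (2 * n))
  have : (n : ℝ) ≠ 0 := by exact_mod_cast hn0
  push_cast
  field_simp
  linarith

/-- The bilinear form on real polynomials for which the monomials are orthogonal with
`⟨X^j, X^j⟩ = j! / 2^{j+1}`, the inner product of `L²(e^{-2|z|²} dA)`. -/
def bargmannPairing (f g : ℝ[X]) : ℝ :=
  g.sum fun j c => f.coeff j * c * ((j ! : ℝ) / 2 ^ (j + 1))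

lemma bargmannPairing_add_left (f f' g : ℝ[X]) :
    bargmannPairing (f + f') g = bargmannPairing f g + bargmannPairing f' g := by
  simp only [bargmannPairing, Polynomial.sum, ← Finset.sum_add_distrib, coeff_add]
  exact Finset.sum_congr rfl fun _ _ => by ring

lemma bargmannPairing_C_mul_left (c : ℝ) (f g : ℝ[X]) :
    bargmannPairing (C c * f) g = c * bargmannPairing f g := by
  simp only [bargmannPairing, Polynomial.sum, Finset.mul_sum, coeff_C_mul]
  exact Finset.sum_congr rfl fun _ _ => by ring

lemma bargmannPairing_add_right (f g g' : ℝ[X]) :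
    bargmannPairing f (g + g') = bargmannPairing f g + bargmannPairing f g' := by
  unfold bargmannPairing
  rw [sum_add_index] <;> intros <;> ring

lemma bargmannPairing_monomial (f : ℝ[X]) (j : ℕ) (c : ℝ) :
    bargmannPairing f (monomial j c) = f.coeff j * c * ((j ! : ℝ) / 2 ^ (j + 1)) := by
  unfold bargmannPairing
  rw [sum_monomial_index]
  ring

lemma bargmannPairing_comm (f g : ℝ[X]) : bargmannPairing f g = bargmannPairing g f := by
  induction f using Polynomial.induction_on' with
  | add p q hp hq => rw [bargmannPairing_add_left, bargmannPairing_add_right, hp, hq]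
  | monomial i b =>
    induction g using Polynomial.induction_on' with
    | add p q hp hq => rw [bargmannPairing_add_left, bargmannPairing_add_right, hp, hq]
    | monomial j c =>
      rw [bargmannPairing_monomial, bargmannPairing_monomial, coeff_monomial, coeff_monomial]
      rcases eq_or_ne i j with rfl | h
      · simp only [if_true]; ring
      · simp [h, h.symm]

/-- The adjointness of multiplication by $X$ and $\frac12\partial$, which turns the skew-product
into a differential operator. -/
lemma bargmannPairing_X_mul_right (f g : ℝ[X]) :
    bargmannPairing f (X * g) = bargmannPairing (C (1 / 2) * derivative f) g := by
  induction g using Polynomial.induction_on' with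
  | add p q hp hq => rw [mul_add, bargmannPairing_add_right, bargmannPairing_add_right, hp, hq]
  | monomial j c =>
    rw [X_mul_monomial, bargmannPairing_monomial, bargmannPairing_monomial, coeff_C_mul,
      coeff_derivative, Nat.factorial_succ]
    push_cast
    field_simp
    ring

lemma bargmannPairing_neg_left (f g : ℝ[X]) :
    bargmannPairing (-f) g = -bargmannPairing f g := by
  have := bargmannPairing_C_mul_left (-1) f g
  simpa using this

lemma bargmannPairing_sub_left (f f' g : ℝ[X]) :
    bargmannPairing (f - f') g = bargmannPairing f g - bargmannPairing f' g := by
  rw [sub_eq_add_neg, bargmannPairing_add_left, bargmannPairing_neg_left, sub_eq_add_neg]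

lemma bargmannPairing_X_sub_C_mul_right (a : ℝ) (f g : ℝ[X]) :
    bargmannPairing f ((X - C a) * g)
      = bargmannPairing (C (1 / 2) * derivative f - C a * f) g := by
  rw [bargmannPairing_sub_left, bargmannPairing_C_mul_left a, ← bargmannPairing_X_mul_right,
    bargmannPairing_comm f, sub_mul, bargmannPairing_sub_left, bargmannPairing_C_mul_left,
    bargmannPairing_comm _ f, bargmannPairing_comm _ f]

/-! ### The skew-product as a form on polynomials -/

/-- The pre-overlap skew-product in terms of the pairing `bargmannPairing`. -/
def preForm (a : ℝ) (f g : ℝ[X]) : ℝ := bargmannPairing (bargmannOp a f) g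

/-- The two brackets come from the summands $1$ and $|z-a|^2$ of the weight, the latter absorbed as
a factor $X-a$ in each argument. The form is visibly antisymmetric in this shape. -/
lemma preForm_eq (a : ℝ) (f g : ℝ[X]) : preForm a f g
    = 2 * (bargmannPairing (X * f) g - bargmannPairing f (X * g))
      + 2 * (bargmannPairing (X * ((X - C a) * f)) ((X - C a) * g)
          - bargmannPairing ((X - C a) * f) (X * ((X - C a) * g))) := by
  rw [bargmannPairing_X_mul_right, bargmannPairing_X_mul_right, bargmannPairing_X_sub_C_mul_right,
    bargmannPairing_X_sub_C_mul_right, ← bargmannPairing_sub_left, ← bargmannPairing_sub_left,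
    ← bargmannPairing_C_mul_left, ← bargmannPairing_C_mul_left, ← bargmannPairing_add_left,
    preForm]
  congr 1
  have h := two_mul_C_half (K := ℝ)
  simp only [bargmannOp, derivative_mul, derivative_sub, derivative_X, derivative_C, C_ofNat,
    derivative_add, zero_mul, zero_add, sub_zero, one_mul]
  set H : ℝ[X] := C (1 / 2)
  clear_value H
  linear_combination (-(C a ^ 2 * derivative f) - ((2 * X - C a) * f
    + X * (X - C a) * derivative f
    - H * (2 * derivative f + (X - C a) * derivative (derivative f))
    + C a * (f + (X - C a) * derivative f))) * h

lemma integral_aeval_mul_conj (f g : ℝ[X]) :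
    Integrable (fun z : ℂ => aeval z f * starRingEnd ℂ (aeval z g)
      * (Real.exp (-2 * ‖z‖ ^ 2) : ℂ)) ∧
    ∫ z : ℂ, aeval z f * starRingEnd ℂ (aeval z g) * (Real.exp (-2 * ‖z‖ ^ 2) : ℂ)
      = ((Real.pi * bargmannPairing f g : ℝ) : ℂ) := by
  induction f using Polynomial.induction_on' with
  | add p q hp hq =>
    simp only [map_add, add_mul, bargmannPairing_add_left]
    refine ⟨hp.1.add hq.1, ?_⟩
    rw [integral_add hp.1 hq.1, hp.2, hq.2]
    push_cast; ring
  | monomial i b =>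
    induction g using Polynomial.induction_on' with
    | add p q hp hq =>
      simp only [map_add, add_mul, mul_add, bargmannPairing_add_right]
      refine ⟨hp.1.add hq.1, ?_⟩
      rw [integral_add hp.1 hq.1, hp.2, hq.2]
      push_cast; ring
    | monomial j c =>
      have h : ∀ z : ℂ, aeval z (monomial i b) * starRingEnd ℂ (aeval z (monomial j c))
          * (Real.exp (-2 * ‖z‖ ^ 2) : ℂ)
          = ((b * c : ℝ) : ℂ)
            * (z ^ i * starRingEnd ℂ z ^ j * (Real.exp (-2 * ‖z‖ ^ 2) : ℂ)) := by
        intro z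
        simp only [aeval_monomial, map_mul, map_pow, Complex.coe_algebraMap, Complex.conj_ofReal]
        push_cast; ring
      simp_rw [h]
      refine ⟨(integrable_pow_mul_conj_pow i j).const_mul _, ?_⟩
      rw [integral_const_mul, bargmannPairing_monomial, coeff_monomial]
      rcases eq_or_ne i j with rfl | hij
      · rw [integral_pow_mul_conj_pow_self, if_pos rfl]
        push_cast; ring
      · rw [integral_pow_mul_conj_pow_of_ne i j hij, if_neg hij]
        simp

lemma skewProduct_preWeight (a : ℝ) (f g : ℝ[X]) :
    skewProduct (preWeight (a : ℂ)) f g = ((preForm a f g : ℝ) : ℂ) := by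
  have key : ∀ z : ℂ, (aeval z f * starRingEnd ℂ (aeval z g)
      - aeval z g * starRingEnd ℂ (aeval z f)) * (z - starRingEnd ℂ z)
        * ((preWeight (a : ℂ) z : ℝ) : ℂ)
      = (((aeval z (X * f) * starRingEnd ℂ (aeval z g) * (Real.exp (-2 * ‖z‖ ^ 2) : ℂ)
        - aeval z f * starRingEnd ℂ (aeval z (X * g)) * (Real.exp (-2 * ‖z‖ ^ 2) : ℂ))
        - (aeval z (X * g) * starRingEnd ℂ (aeval z f) * (Real.exp (-2 * ‖z‖ ^ 2) : ℂ)
        - aeval z g * starRingEnd ℂ (aeval z (X * f)) * (Real.exp (-2 * ‖z‖ ^ 2) : ℂ)))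
        + ((aeval z (X * ((X - C a) * f)) * starRingEnd ℂ (aeval z ((X - C a) * g))
            * (Real.exp (-2 * ‖z‖ ^ 2) : ℂ)
          - aeval z ((X - C a) * f) * starRingEnd ℂ (aeval z (X * ((X - C a) * g)))
            * (Real.exp (-2 * ‖z‖ ^ 2) : ℂ))
        - (aeval z (X * ((X - C a) * g)) * starRingEnd ℂ (aeval z ((X - C a) * f))
            * (Real.exp (-2 * ‖z‖ ^ 2) : ℂ)
          - aeval z ((X - C a) * g) * starRingEnd ℂ (aeval z (X * ((X - C a) * f)))
            * (Real.exp (-2 * ‖z‖ ^ 2) : ℂ)))) := by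
    intro z
    have hn : ((‖z - (a : ℂ)‖ : ℝ) : ℂ) ^ 2 = (z - a) * (starRingEnd ℂ z - a) := by
      have := Complex.mul_conj (z - (a : ℂ))
      rw [Complex.normSq_eq_norm_sq, map_sub, Complex.conj_ofReal] at this
      rw [this]; push_cast; rfl
    simp only [preWeight, map_mul, map_sub, aeval_X, aeval_C, Complex.coe_algebraMap,
      Complex.conj_ofReal, Complex.ofReal_mul, Complex.ofReal_add, Complex.ofReal_one,
      Complex.ofReal_pow, hn]
    ring
  have hi := fun p q => (integral_aeval_mul_conj p q).1
  have hv := fun p q => (integral_aeval_mul_conj p q).2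
  unfold skewProduct
  simp_rw [key]
  rw [integral_add, integral_sub, integral_sub, integral_sub, integral_sub, integral_sub,
    integral_sub, hv, hv, hv, hv, hv, hv, hv, hv, preForm_eq, bargmannPairing_comm (X * g) f,
    bargmannPairing_comm g (X * f), bargmannPairing_comm (X * ((X - C a) * g)),
    bargmannPairing_comm ((X - C a) * g) (X * ((X - C a) * f))]
  · have : (Real.pi : ℂ) ≠ 0 := by exact_mod_cast Real.pi_ne_zero
    push_cast
    field_simp
    ring
  all_goals
    repeat' first
      | exact hi _ _
      | exact (hi _ _).sub (hi _ _)
      | exact ((hi _ _).sub (hi _ _)).sub ((hi _ _).sub (hi _ _))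

lemma preForm_add_left (a : ℝ) (f f' g : ℝ[X]) :
    preForm a (f + f') g = preForm a f g + preForm a f' g := by
  rw [preForm, bargmannOp_add, bargmannPairing_add_left]; rfl

lemma preForm_C_mul_left (a c : ℝ) (f g : ℝ[X]) :
    preForm a (C c * f) g = c * preForm a f g := by
  rw [preForm, bargmannOp_C_mul, bargmannPairing_C_mul_left]; rfl

lemma preForm_comm (a : ℝ) (f g : ℝ[X]) : preForm a f g = -preForm a g f := by
  rw [preForm_eq, preForm_eq, bargmannPairing_comm (X * f) g, bargmannPairing_comm f (X * g),
    bargmannPairing_comm (X * ((X - C a) * f)), bargmannPairing_comm ((X - C a) * f)]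
  ring

lemma preForm_self (a : ℝ) (f : ℝ[X]) : preForm a f f = 0 := by
  linarith [preForm_comm a f f]

lemma preForm_add_right (a : ℝ) (f g g' : ℝ[X]) :
    preForm a f (g + g') = preForm a f g + preForm a f g' :=
  bargmannPairing_add_right _ _ _

lemma preForm_C_mul_right (a c : ℝ) (f g : ℝ[X]) :
    preForm a f (C c * g) = c * preForm a f g := by
  rw [preForm_comm, preForm_C_mul_left, preForm_comm]; ring

lemma preForm_sub_left (a : ℝ) (f f' g : ℝ[X]) :
    preForm a (f - f') g = preForm a f g - preForm a f' g := by
  have := preForm_C_mul_left a (-1) f' g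
  rw [C_neg, C_1, neg_one_mul] at this
  rw [sub_eq_add_neg, preForm_add_left, this]; ring

lemma preForm_X_pow (a : ℝ) (f : ℝ[X]) (j : ℕ) :
    preForm a f (X ^ j) = (bargmannOp a f).coeff j * ((j ! : ℝ) / 2 ^ (j + 1)) := by
  rw [preForm, ← monomial_one_right_eq_X_pow, bargmannPairing_monomial, mul_one]

lemma bargmannPairing_X_pow_left (g : ℝ[X]) (j : ℕ) :
    bargmannPairing (X ^ j) g = g.coeff j * ((j ! : ℝ) / 2 ^ (j + 1)) := by
  rw [bargmannPairing_comm, ← monomial_one_right_eq_X_pow, bargmannPairing_monomial, mul_one]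

lemma coeff_bargmannOp (a : ℝ) (f : ℝ[X]) (m : ℕ) : (bargmannOp a f).coeff (m + 2)
    = -2 * a * f.coeff m + ((m : ℝ) + 5 + 2 * a ^ 2) * f.coeff (m + 1)
      - 1 / 2 * ((m + 3) * (m + 6 + 2 * a ^ 2)) * f.coeff (m + 3)
      + 1 / 2 * a * ((m + 3) * (m + 4)) * f.coeff (m + 4) := by
  have h : bargmannOp a f = C (-2 * a) * (f * X ^ 2) + C (4 + 2 * a ^ 2) * (f * X)
      + derivative f * X ^ 2 - C (1 / 2) * (C (4 + 2 * a ^ 2) * derivative f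
        + derivative (derivative f) * X) + C (1 / 2 * a) * derivative (derivative f) := by
    simp only [bargmannOp, C_mul, C_add, C_neg, C_ofNat, C_pow]
    ring
  rw [h]
  simp only [coeff_add, coeff_sub, coeff_C_mul, coeff_mul_X_pow, coeff_derivative]
  rw [show m + 2 = m + 1 + 1 by ring]
  simp only [coeff_mul_X, coeff_derivative]
  push_cast
  ring

/-! ### Representing the top coefficients -/

lemma oddCoeff_mul_factorial (n : ℕ) :
    2 * oddCoeff (n + 1) * ((n : ℝ) + 1) * (((2 * n + 1)! : ℝ) / 2 ^ (2 * n + 1 + 1))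
      = ((n + 1)! : ℝ) := by
  have h : (2 * (n + 1))! = (2 * n + 2) * (2 * n + 1)! := by
    rw [show 2 * (n + 1) = 2 * n + 1 + 1 by ring, Nat.factorial_succ]
  have h0 : ((2 * n + 1)! : ℝ) ≠ 0 := by positivity
  have h1 : ((n : ℝ) + 1) ≠ 0 := by positivity
  have h2 : (2 * (n : ℝ) + 2) ≠ 0 := by positivity
  have h3 : (2 : ℝ) ^ (2 * n + 1 + 1) = 4 ^ (n + 1) := by
    rw [show 2 * n + 1 + 1 = 2 * (n + 1) by ring, pow_mul]; norm_num
  unfold oddCoeff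
  rw [h, h3]
  push_cast
  field_simp

/-- The normalisation of the top coefficient of the skew-kernel. -/
def topNorm (a : ℝ) (n : ℕ) : ℝ := 4 * ((n + 1)! : ℝ) * fReal (n + 2) (a ^ 2)

lemma topNorm_pos (a : ℝ) (n : ℕ) : 0 < topNorm a n := by
  have := fReal_pos (n + 1) (a ^ 2) (sq_nonneg a)
  unfold topNorm
  positivity

/-- The image of $F$ has only powers $2n+1$ and $2n+2$, and the second pairs to zero with `g` by
degree. -/
lemma preForm_topPoly (a : ℝ) (n : ℕ) (F g : ℝ[X]) (hg : g.natDegree < 2 * n + 2)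
    (hF : bargmannOp a F = C (8 * oddCoeff (n + 1)) * X ^ (2 * n + 1)
      * (C (((n : ℝ) + 1) * fReal (n + 2) (a ^ 2)) - C (a * fReal (n + 1) (a ^ 2)) * X)) :
    preForm a F g = topNorm a n * g.coeff (2 * n + 1) := by
  have h : bargmannOp a F
      = C (8 * oddCoeff (n + 1) * (((n : ℝ) + 1) * fReal (n + 2) (a ^ 2))) * X ^ (2 * n + 1)
        - C (8 * oddCoeff (n + 1) * (a * fReal (n + 1) (a ^ 2))) * X ^ (2 * n + 2) := by
    simp only [hF, C_mul, C_ofNat]; ring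
  rw [preForm, h, bargmannPairing_sub_left, bargmannPairing_C_mul_left, bargmannPairing_C_mul_left,
    bargmannPairing_X_pow_left, bargmannPairing_X_pow_left,
    coeff_eq_zero_of_natDegree_lt (n := 2 * n + 2) hg, topNorm]
  linear_combination (4 * fReal (n + 2) (a ^ 2) * g.coeff (2 * n + 1)) * oddCoeff_mul_factorial n

/-- The represented functional is, up to `-topNorm a n`, the coefficient of $z^{2n+2}$ in
`bargmannOp a g`. The power $2n+3$ in the image of $G$ is invisible to `g`. -/
lemma preForm_subPoly (a : ℝ) (n : ℕ) (G g : ℝ[X]) (hg : g.natDegree < 2 * n + 2)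
    (hG : bargmannOp a G = C (-(4 * oddCoeff (n + 1))) * X ^ (2 * n)
      * (C (-(2 * a * (n + 1) * (2 * n + 1) * fReal (n + 2) (a ^ 2)))
        + C (2 * (n + 1) * (2 * n + 5 + 2 * a ^ 2) * fReal (n + 2) (a ^ 2)) * X
        - C (4 * a ^ 2 * fReal (n + 1) (a ^ 2)) * X ^ 3)) :
    preForm a G g = -topNorm a n
      * ((2 * n + 5 + 2 * a ^ 2) * g.coeff (2 * n + 1) - 2 * a * g.coeff (2 * n)) := by
  have h : bargmannOp a G
      = C (-(4 * oddCoeff (n + 1)) * (-(2 * a * (n + 1) * (2 * n + 1) * fReal (n + 2) (a ^ 2))))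
          * X ^ (2 * n)
        + C (-(4 * oddCoeff (n + 1)) * (2 * (n + 1) * (2 * n + 5 + 2 * a ^ 2)
          * fReal (n + 2) (a ^ 2))) * X ^ (2 * n + 1)
        - C (-(4 * oddCoeff (n + 1)) * (4 * a ^ 2 * fReal (n + 1) (a ^ 2))) * X ^ (2 * n + 3) := by
    rw [hG, C_mul (a := -(4 * oddCoeff (n + 1))), C_mul (a := -(4 * oddCoeff (n + 1))),
      C_mul (a := -(4 * oddCoeff (n + 1)))]
    ring
  have h1 := oddCoeff_mul_factorial n
  have h2 : 4 * oddCoeff (n + 1) * ((n : ℝ) + 1) * (2 * n + 1)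
      * (((2 * n)! : ℝ) / 2 ^ (2 * n + 1)) = 4 * ((n + 1)! : ℝ) := by
    rw [← h1, Nat.factorial_succ (2 * n), pow_succ 2 (2 * n + 1)]
    push_cast
    field_simp
  rw [preForm, h, bargmannPairing_sub_left, bargmannPairing_add_left, bargmannPairing_C_mul_left,
    bargmannPairing_C_mul_left, bargmannPairing_C_mul_left, bargmannPairing_X_pow_left,
    bargmannPairing_X_pow_left, bargmannPairing_X_pow_left,
    coeff_eq_zero_of_natDegree_lt (n := 2 * n + 3) (by omega), topNorm]
  linear_combination (-4 * (2 * n + 5 + 2 * a ^ 2) * fReal (n + 2) (a ^ 2) * g.coeff (2 * n + 1))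
      * h1 + (2 * a * fReal (n + 2) (a ^ 2) * g.coeff (2 * n)) * h2

/-! ### Existence of a skew-orthogonal family -/

/-- Induction along a sequence of polynomials `q k` of degree `k`. -/
lemma degreeLT_induction (q : ℕ → ℝ[X]) (hq : ∀ k, (q k).degree = (k : WithBot ℕ))
    {P : ℝ[X] → Prop} (zero : P 0) (add : ∀ f g, P f → P g → P (f + g))
    (smul : ∀ c f, P f → P (C c * f)) (n : ℕ) (mem : ∀ k < n, P (q k)) :
    ∀ f ∈ degreeLT ℝ n, P f := by
  induction n with
  | zero =>
    intro f hf
    rw [mem_degreeLT] at hf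
    have : f = 0 := by
      by_contra h
      rw [degree_eq_natDegree h] at hf
      exact absurd (by exact_mod_cast hf) (Nat.not_lt_zero _)
    rwa [this]
  | succ n ih =>
    intro f hf
    rw [mem_degreeLT] at hf
    have hlc : (q n).coeff n ≠ 0 := by
      have h0 : q n ≠ 0 := fun h => by simpa [h] using hq n
      have := leadingCoeff_ne_zero.mpr h0
      rwa [leadingCoeff, natDegree_eq_of_degree_eq_some (hq n)] at this
    set c := f.coeff n / (q n).coeff n
    have h1 : f - C c * q n ∈ degreeLT ℝ n := by
      rw [mem_degreeLT, degree_lt_iff_coeff_zero]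
      intro m hm
      rw [coeff_sub, coeff_C_mul]
      rcases hm.eq_or_lt with rfl | h
      · simp only [c]; field_simp; ring
      · rw [coeff_eq_zero_of_degree_lt (p := q n) (by rw [hq n]; exact_mod_cast h),
          coeff_eq_zero_of_degree_lt (lt_of_lt_of_le hf (by exact_mod_cast h))]
        ring
    have := add _ _ (ih (fun k hk => mem k (by omega)) _ h1) (smul c _ (mem n (by omega)))
    rwa [sub_add_cancel] at this

lemma natDegree_lt_of_mem_degreeLT {n : ℕ} (hn : 0 < n) {f : ℝ[X]} (hf : f ∈ degreeLT ℝ n) :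
    f.natDegree < n := by
  rcases eq_or_ne f 0 with rfl | h
  · simpa using hn
  · rwa [natDegree_lt_iff_degree_lt h, ← mem_degreeLT]

lemma mem_degreeLT_of_degree_eq {f : ℝ[X]} {k n : ℕ} (hf : f.degree = (k : WithBot ℕ))
    (h : k < n) : f ∈ degreeLT ℝ n := by
  rw [mem_degreeLT, hf]; exact_mod_cast h

/-- Given real polynomials `F k` of degree `2k` which are skew-orthogonal to the polynomials of
degree at most `2k`, complementary skew-orthogonal polynomials of odd degree. -/
lemma exists_oddPoly (a : ℝ) (F : ℕ → ℝ[X]) (c : ℕ → ℝ) (hc : ∀ k, 0 < c k)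
    (hd : ∀ k, (F k).degree = ((2 * k : ℕ) : WithBot ℕ))
    (hF : ∀ k g, g.natDegree < 2 * k + 2 → preForm a (F k) g = c k * g.coeff (2 * k + 1)) (k : ℕ) :
    (∀ ℓ : ℝ[X] →ₗ[ℝ] ℝ, ∃ h ∈ degreeLT ℝ (2 * k), ∀ g ∈ degreeLT ℝ (2 * k),
      preForm a h g = ℓ g) ∧
    ∃ p : ℝ[X], p.degree = ((2 * k + 1 : ℕ) : WithBot ℕ) ∧ p.coeff (2 * k + 1) = 1 ∧
      ∀ g ∈ degreeLT ℝ (2 * k), preForm a p g = 0 := by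
  have step : ∀ k, (∀ ℓ : ℝ[X] →ₗ[ℝ] ℝ, ∃ h ∈ degreeLT ℝ (2 * k), ∀ g ∈ degreeLT ℝ (2 * k),
      preForm a h g = ℓ g) → ∃ p : ℝ[X], p.degree = ((2 * k + 1 : ℕ) : WithBot ℕ) ∧
      p.coeff (2 * k + 1) = 1 ∧ ∀ g ∈ degreeLT ℝ (2 * k), preForm a p g = 0 := by
    intro k hk
    -- Representability in degree below $2k$ lets the pairing with $X^{2k+1}$ be subtracted off.
    obtain ⟨h, hh, hg⟩ := hk
      { toFun := fun g => preForm a (X ^ (2 * k + 1)) g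
        map_add' := preForm_add_right a _
        map_smul' := fun c g => by
          rw [smul_eq_C_mul, preForm_C_mul_right]; rfl }
    have hlt : h.degree < ((2 * k + 1 : ℕ) : WithBot ℕ) :=
      lt_of_lt_of_le (mem_degreeLT.mp hh) (by exact_mod_cast Nat.le_succ _)
    refine ⟨X ^ (2 * k + 1) - h, ?_, ?_, fun g hg' => ?_⟩
    · rw [degree_sub_eq_left_of_degree_lt] <;> rw [degree_X_pow]
      exact hlt
    · rw [coeff_sub, coeff_X_pow, if_pos rfl, coeff_eq_zero_of_degree_lt hlt, sub_zero]
    · rw [preForm_sub_left, hg g hg']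
      exact sub_self _
  induction k with
  | zero =>
    have h0 : ∀ ℓ : ℝ[X] →ₗ[ℝ] ℝ, ∃ h ∈ degreeLT ℝ (2 * 0), ∀ g ∈ degreeLT ℝ (2 * 0),
        preForm a h g = ℓ g := by
      intro ℓ
      refine ⟨0, Submodule.zero_mem _, fun g hg => ?_⟩
      have : g = 0 := by
        by_contra h
        rw [mem_degreeLT, degree_eq_natDegree h] at hg
        exact absurd (by exact_mod_cast hg) (Nat.not_lt_zero _)
      rw [this, preForm_self, map_zero]
    exact ⟨h0, step 0 h0⟩
  | succ k ih =>
    obtain ⟨ih1, p, hp, hp1, hp2⟩ := ih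
    have main : ∀ ℓ : ℝ[X] →ₗ[ℝ] ℝ, ∃ h ∈ degreeLT ℝ (2 * (k + 1)),
        ∀ g ∈ degreeLT ℝ (2 * (k + 1)), preForm a h g = ℓ g := by
      intro ℓ
      obtain ⟨h, hh, hℓ⟩ := ih1 ℓ
      have hFp : preForm a (F k) p = c k := by
        rw [hF k p (by rw [natDegree_eq_of_degree_eq_some hp]; omega), hp1, mul_one]
      have hFg : ∀ g ∈ degreeLT ℝ (2 * k), preForm a (F k) g = 0 := by
        intro g hg
        have : g.degree < ((2 * k + 1 : ℕ) : WithBot ℕ) :=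
          lt_of_lt_of_le (mem_degreeLT.mp hg) (by exact_mod_cast Nat.le_succ _)
        rw [hF k g (natDegree_lt_of_mem_degreeLT (by omega) (mem_degreeLT.mpr
          (this.trans_le (by exact_mod_cast Nat.le_succ _)))), coeff_eq_zero_of_degree_lt this,
          mul_zero]
      have hmono : degreeLT ℝ (2 * k) ≤ degreeLT ℝ (2 * (k + 1)) :=
        degreeLT_mono (by omega)
      have hck := (hc k).ne'
      -- `F k` and `p` are skew-orthogonal to all lower degrees and pair to `c k` with each other.
      -- Their coefficients are therefore fixed by the values required at `p` and at `F k`, without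
      -- disturbing `h`.
      refine ⟨h + (C ((ℓ p - preForm a h p) / c k) * F k + C (-(ℓ (F k)) / c k) * p), ?_, ?_⟩
      · refine Submodule.add_mem _ (hmono hh) (Submodule.add_mem _ ?_ ?_)
        · rw [← smul_eq_C_mul]
          exact Submodule.smul_mem _ _ (mem_degreeLT_of_degree_eq (hd k) (by omega))
        · rw [← smul_eq_C_mul]
          exact Submodule.smul_mem _ _ (mem_degreeLT_of_degree_eq hp (by omega))
      -- A basis adapted to the new hyperbolic pair; monomials occupy the remaining degrees.
      · let s : ℕ → ℝ[X] := fun j => if j = 2 * k then F k else if j = 2 * k + 1 then p else X ^ j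
        refine degreeLT_induction s ?_ ?_ ?_ ?_ _ ?_
        · intro j
          simp only [s]
          split_ifs with h1 h2
          · rw [h1, hd]
          · rw [h2, hp]
          · exact degree_X_pow j
        · rw [map_zero]
          simpa using preForm_C_mul_right a 0 (h + (C ((ℓ p - preForm a h p) / c k) * F k
            + C (-(ℓ (F k)) / c k) * p)) 0
        · intro f g hf hg
          rw [preForm_add_right, hf, hg, map_add]
        · intro b f hf
          rw [preForm_C_mul_right, hf, ← smul_eq_C_mul, map_smul, smul_eq_mul]
        · intro j hj
          simp only [preForm_add_left, preForm_C_mul_left, s]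
          split_ifs with h1 h2
          · rw [preForm_self, preForm_comm a p, hFp, preForm_comm a h, hFg h hh]
            field_simp; ring
          · rw [preForm_self, hFp]
            field_simp; ring
          · have : (X ^ j : ℝ[X]) ∈ degreeLT ℝ (2 * k) :=
              mem_degreeLT_of_degree_eq (degree_X_pow j) (by omega)
            rw [hℓ _ this, hFg _ this, hp2 _ this]
            ring
    exact ⟨main, step _ main⟩

/-- The quotients from `exists_topPoly` are the even members, their complements from
`exists_oddPoly` the odd ones. Positivity of the skew-norms is that of $f_N(a^2)$. -/
lemma exists_isPlanarSOP (a : ℝ) :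
    ∃ (q : ℕ → ℝ[X]) (r : ℕ → ℝ), IsPlanarSOP (preWeight (a : ℂ)) q r := by
  choose F hF0 hFdeg hFne hFT using exists_topPoly a
  have hd : ∀ k, (F k).degree = ((2 * k : ℕ) : WithBot ℕ) := fun k => by
    rw [degree_eq_natDegree (hFne k), hFdeg]
  have hF : ∀ k g, g.natDegree < 2 * k + 2 →
      preForm a (F k) g = topNorm a k * g.coeff (2 * k + 1) :=
    fun k g hg => preForm_topPoly a k _ g hg (hFT k)
  choose p hp hp1 hp2 using fun k => (exists_oddPoly a F _ (topNorm_pos a) hd hF k).2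
  have hFp : ∀ k l, preForm a (F k) (p l) = if k = l then topNorm a k else 0 := by
    intro k l
    rcases lt_trichotomy k l with h | h | h
    · rw [if_neg h.ne, preForm_comm, hp2 l _ (mem_degreeLT_of_degree_eq (hd k) (by omega)),
        neg_zero]
    · subst h
      rw [if_pos rfl, hF k _ (by rw [natDegree_eq_of_degree_eq_some (hp k)]; omega), hp1, mul_one]
    · have := natDegree_eq_of_degree_eq_some (hp l)
      rw [if_neg h.ne', hF k _ (by omega), coeff_eq_zero_of_natDegree_lt (by omega), mul_zero]
  have hFF : ∀ k l, l ≤ k → preForm a (F k) (F l) = 0 := by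
    intro k l h
    have := hFdeg l
    rw [hF k _ (by omega), coeff_eq_zero_of_natDegree_lt (by omega), mul_zero]
  have hpp : ∀ k l, l ≤ k → preForm a (p k) (p l) = 0 := by
    intro k l h
    rcases h.eq_or_lt with rfl | h
    · exact preForm_self _ _
    · exact hp2 k _ (mem_degreeLT_of_degree_eq (hp l) (by omega))
  have he : ∀ k, (if 2 * k % 2 = 0 then F (2 * k / 2) else p (2 * k / 2)) = F k := fun k => by
    rw [if_pos (by omega), Nat.mul_div_cancel_left k (by norm_num)]
  have ho : ∀ k, (if (2 * k + 1) % 2 = 0 then F ((2 * k + 1) / 2) else p ((2 * k + 1) / 2)) = p k :=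
    fun k => by rw [if_neg (by omega), show (2 * k + 1) / 2 = k by omega]
  refine ⟨fun m => if m % 2 = 0 then F (m / 2) else p (m / 2), topNorm a, ?_, topNorm_pos a,
    ?_, ?_, ?_, ?_⟩
  · intro m
    split_ifs with h
    · rw [hd]; congr 1; omega
    · rw [hp]; congr 1; omega
  · intro k l
    simp only [he, skewProduct_preWeight]
    rcases le_total l k with h | h
    · simp [hFF k l h]
    · simp [preForm_comm a (F k), hFF l k h]
  · intro k l
    simp only [ho, skewProduct_preWeight]
    rcases le_total l k with h | h
    · simp [hpp k l h]
    · simp [preForm_comm a (p k), hpp l k h]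
  · intro k l
    simp only [he, ho, skewProduct_preWeight, hFp]
    split_ifs <;> simp
  · intro k l
    simp only [he, ho, skewProduct_preWeight, preForm_comm a (p l), hFp]
    split_ifs <;> simp

/-! ### Polynomial forms of the functions in the statement -/

lemma integral_pow_mul_exp_neg (m : ℕ) :
    IntegrableOn (fun s : ℝ => (s : ℂ) ^ m * Complex.exp (-(s : ℂ))) (Set.Ioi 0) ∧
    ∫ s : ℝ in Set.Ioi 0, (s : ℂ) ^ m * Complex.exp (-(s : ℂ)) = (m ! : ℂ) := by
  have h : ∀ s : ℝ, (s : ℂ) ^ m * Complex.exp (-(s : ℂ))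
      = ((Real.exp (-s) * s ^ ((m + 1 : ℝ) - 1) : ℝ) : ℂ) := by
    intro s
    rw [add_sub_cancel_right, Real.rpow_natCast]
    push_cast
    ring
  simp_rw [h]
  constructor
  · exact (Real.GammaIntegral_convergent (by positivity)).ofReal
  · rw [integral_complex_ofReal, ← Real.Gamma_eq_integral (by positivity),
      Real.Gamma_nat_eq_factorial]
    simp

/-- Binomial expansion along the ray reduces the integral to moments $\int_0^\infty s^m
e^{-s}\,ds=m!$. -/
lemma regGammaQ_eq (n : ℕ) (z : ℂ) :
    regGammaQ (n + 1) z = Complex.exp (-z) * ∑ j ∈ Finset.range (n + 1), z ^ j / (j ! : ℂ) := by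
  have h : ∀ s : ℝ, (z + (s : ℂ)) ^ (n + 1 - 1) * Complex.exp (-(z + (s : ℂ)))
      = ∑ m ∈ Finset.range (n + 1), (Complex.exp (-z) * z ^ m * (n.choose m : ℂ))
        * ((s : ℂ) ^ (n - m) * Complex.exp (-(s : ℂ))) := by
    intro s
    rw [Nat.add_sub_cancel, add_pow, Finset.sum_mul, neg_add, Complex.exp_add]
    exact Finset.sum_congr rfl fun m _ => by ring
  unfold regGammaQ
  simp_rw [h]
  rw [integral_finsetSum _ fun m _ => ((integral_pow_mul_exp_neg (n - m)).1).const_mul _]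
  simp_rw [integral_const_mul, (integral_pow_mul_exp_neg _).2]
  rw [Nat.cast_add_one, Complex.Gamma_nat_eq_factorial, Finset.mul_sum, Finset.mul_sum]
  refine Finset.sum_congr rfl fun m hm => ?_
  have hmn : m ≤ n := Nat.lt_succ_iff.mp (Finset.mem_range.mp hm)
  have h1 : (n.choose m : ℂ) * (m ! : ℂ) * ((n - m)! : ℂ) = (n ! : ℂ) := by
    exact_mod_cast Nat.choose_mul_factorial_mul_factorial hmn
  have h2 : (n ! : ℂ) ≠ 0 := by exact_mod_cast n.factorial_ne_zero
  have h3 : (m ! : ℂ) ≠ 0 := by exact_mod_cast m.factorial_ne_zero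
  field_simp
  linear_combination z ^ m * h1

lemma doubleFactorial_mul_oddCoeff (k : ℕ) :
    (((2 * k + 1)‼ : ℕ) : ℝ) * oddCoeff (k + 1) = 2 ^ (k + 1) := by
  induction k with
  | zero => norm_num [oddCoeff, Nat.factorial]
  | succ k ih =>
    have h := oddCoeff_succ (k + 1)
    rw [show 2 * (k + 1) + 1 = 2 * k + 1 + 2 by ring, Nat.doubleFactorial_add_two]
    push_cast at h ⊢
    rw [pow_succ, ← ih]
    linear_combination (((2 * k + 1)‼ : ℕ) : ℝ) * h

lemma ginSEKernel_eq (a : ℝ) (k : ℕ) (t : ℂ) :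
    ginSEKernel k t (a : ℂ) = aeval t (ginPoly a k) := by
  have hs : ((√2 : ℝ) : ℂ) ^ 2 = 2 := by
    rw [← Complex.ofReal_pow, Real.sq_sqrt (by norm_num)]; norm_num
  have hodd : ∀ (j : ℕ) (x : ℂ), ((√2 : ℝ) : ℂ)
      * ((((√2 : ℝ) : ℂ) * x) ^ (2 * j + 1) / (((2 * j + 1)‼ : ℕ) : ℂ))
      = (oddCoeff (j + 1) : ℂ) * x ^ (2 * j + 1) := by
    intro j x
    have h1 : (((2 * j + 1)‼ : ℕ) : ℂ) * (oddCoeff (j + 1) : ℂ) = 2 ^ (j + 1) := by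
      exact_mod_cast congrArg (fun r : ℝ => (r : ℂ)) (doubleFactorial_mul_oddCoeff j)
    have h2 : (((2 * j + 1)‼ : ℕ) : ℂ) ≠ 0 := by
      exact_mod_cast (Nat.doubleFactorial_pos _).ne'
    rw [mul_pow, pow_succ, pow_mul, hs]
    field_simp
    rw [hs]
    linear_combination (-x ^ (2 * j + 1)) * h1
  have heven : ∀ (l : ℕ) (x : ℂ), (((√2 : ℝ) : ℂ) * x) ^ (2 * l) / (((2 * l)‼ : ℕ) : ℂ)
      = x ^ (2 * l) / (l ! : ℂ) := by
    intro l x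
    rw [mul_pow, pow_mul, hs, Nat.doubleFactorial_two_mul]
    push_cast
    rw [mul_div_mul_left _ _ (pow_ne_zero l two_ne_zero)]
  unfold ginSEKernel ginPoly
  rw [map_sum, Finset.mul_sum]
  refine Finset.sum_congr rfl fun j _ => ?_
  rw [Finset.sum_sub_distrib, ← Finset.mul_sum, ← Finset.mul_sum, mul_sub, ← mul_assoc,
    ← mul_assoc, hodd, hodd]
  simp_rw [heven]
  simp only [evenExp, expSum, map_mul, map_sub, aeval_C, map_pow, aeval_X, map_sum,
    Complex.coe_algebraMap]
  push_cast
  have : ∀ x : ℂ, ∑ l ∈ Finset.range (j + 1), 1 / (l ! : ℂ) * x ^ (2 * l)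
      = ∑ l ∈ Finset.range (j + 1), x ^ (2 * l) / (l ! : ℂ) := fun x =>
    Finset.sum_congr rfl fun l _ => by ring
  rw [this]
  simp_rw [← pow_mul]
  ring

lemma LHat_eq (a : ℝ) (k : ℕ) (w : ℂ) :
    LHat k w (a : ℂ) = Complex.exp (-2 * w * a) * aeval w (ginWronskian a k) := by
  -- At $w=a$ the prefactor kills whatever value `deriv` takes there, and the Wronskian vanishes
  -- too.
  rcases eq_or_ne w (a : ℂ) with rfl | hw
  · have h : aeval (a : ℂ) (ginWronskian a k) = 0 := by
      have := aeval_algebraMap_apply_eq_algebraMap_eval (A := ℂ) a (ginWronskian a k)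
      rw [eval_ginWronskian_self, map_zero] at this
      exact this
    simp [LHat, h]
  · have hw' : w - (a : ℂ) ≠ 0 := sub_ne_zero.mpr hw
    have h1 : HasDerivAt (fun t : ℂ => Complex.exp (-2 * t * a))
        (Complex.exp (-2 * w * a) * (-2 * a)) w := by
      have := (((hasDerivAt_id w).const_mul (-2)).mul_const (a : ℂ)).cexp
      simpa using this
    have h2 := h1.mul ((ginPoly a k).hasDerivAt_aeval w)
    have h3 := h2.div ((hasDerivAt_id w).sub_const (a : ℂ)) hw'
    have h4 : (fun t : ℂ => ginSEKernelHat k t a / (t - a))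
        = fun t : ℂ => Complex.exp (-2 * t * a) * aeval t (ginPoly a k) / (t - a) := by
      funext t
      rw [ginSEKernelHat, ginSEKernel_eq]
    unfold LHat
    rw [h4]
    have h5 : deriv (fun t : ℂ => Complex.exp (-2 * t * a) * aeval t (ginPoly a k) / (t - a)) w
      = _ := h3.deriv
    rw [h5]
    simp only [ginWronskian, twistDeriv, map_sub, map_mul, aeval_X, aeval_C, map_ofNat, id_eq,
      Complex.coe_algebraMap, Pi.mul_apply]
    field_simp
    ring

lemma truncExp_eq (a : ℝ) (k : ℕ) :
    truncExp k ((a : ℂ) ^ 2) = (expSum (k + 1) (a ^ 2) : ℂ) := by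
  simp [truncExp, expSum]

lemma fSum_eq (a : ℝ) (k : ℕ) : fSum k ((a : ℂ) ^ 2) = (fReal (k + 1) (a ^ 2) : ℂ) := by
  simp [fSum, fReal]

/-! ### The operator applied to the rescaled kernel -/

lemma deriv_exp_mul_eval (a c : ℂ) (P : ℂ[X]) :
    deriv (fun t : ℂ => c * Complex.exp (-2 * t * a) * P.eval t)
      = fun t : ℂ => c * Complex.exp (-2 * t * a) * (twistDeriv a P).eval t := by
  funext t
  have h1 : HasDerivAt (fun t : ℂ => Complex.exp (-2 * t * a))
      (Complex.exp (-2 * t * a) * (-2 * a)) t := by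
    have := (((hasDerivAt_id t).const_mul (-2)).mul_const a).cexp
    simpa using this
  have h2 := (h1.const_mul c).mul (P.hasDerivAt t)
  have h3 : deriv (fun t : ℂ => c * Complex.exp (-2 * t * a) * P.eval t) t = _ := h2.deriv
  rw [h3]
  simp [twistDeriv]
  ring

lemma preOperator_exp_mul_eval (a c : ℂ) (P : ℂ[X]) (z : ℂ) :
    preOperator a (fun t : ℂ => c * Complex.exp (-2 * t * a) * P.eval t) z
      = c * Complex.exp (-2 * z * a) * (twistOp a P).eval z := by
  rw [preOperator, deriv_exp_mul_eval, deriv_exp_mul_eval]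
  simp [twistOp]
  ring

lemma bargmannOp_map (a : ℝ) (f : ℝ[X]) :
    bargmannOp (a : ℂ) (f.map (algebraMap ℝ ℂ)) = (bargmannOp a f).map (algebraMap ℝ ℂ) := by
  simp [bargmannOp, Polynomial.derivative_map]

lemma bargmannOp_sum {K ι : Type*} [Field K] (a : K) (s : Finset ι) (f : ι → K[X]) :
    bargmannOp a (∑ i ∈ s, f i) = ∑ i ∈ s, bargmannOp a (f i) := by
  classical
  induction s using Finset.induction_on with
  | empty => simp [bargmannOp]
  | insert i s hi ih => rw [Finset.sum_insert hi, Finset.sum_insert hi, bargmannOp_add, ih]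

lemma preOperator_rescaledKernel (a : ℝ) (q : ℕ → ℝ[X]) (r : ℕ → ℝ) (N : ℕ) (z w : ℂ) :
    preOperator (a : ℂ) (fun t : ℂ => rescaledKernel (a : ℂ) (skewKernel q r N) t w) z
      = -2 * (z - a) ^ 3 * (w - a) ^ 3 * Complex.exp (2 * a ^ 2 - 2 * z * a - 2 * w * a)
        * ∑ k ∈ Finset.range N,
          (aeval z (bargmannOp a (q (2 * k + 1))) * aeval w (q (2 * k))
            - aeval z (bargmannOp a (q (2 * k))) * aeval w (q (2 * k + 1))) / (r k : ℂ) := by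
  set K : ℂ[X] := ∑ k ∈ Finset.range N,
    (C (aeval w (q (2 * k)) / (r k : ℂ)) * (q (2 * k + 1)).map (algebraMap ℝ ℂ)
      + C (-(aeval w (q (2 * k + 1)) / (r k : ℂ))) * (q (2 * k)).map (algebraMap ℝ ℂ)) with hK
  have h1 : (fun t : ℂ => rescaledKernel (a : ℂ) (skewKernel q r N) t w)
      = fun t : ℂ => ((w - a) ^ 3 * Complex.exp (2 * a ^ 2 - 2 * w * a))
        * Complex.exp (-2 * t * a) * ((X - C (a : ℂ)) ^ 3 * K).eval t := by
    funext t
    have he : Complex.exp (2 * (a : ℂ) ^ 2 - 2 * t * a - 2 * w * a)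
        = Complex.exp (2 * (a : ℂ) ^ 2 - 2 * w * a) * Complex.exp (-2 * t * a) := by
      rw [← Complex.exp_add]; congr 1; ring
    have hk : skewKernel q r N t w = K.eval t := by
      rw [hK, eval_finsetSum, skewKernel]
      refine Finset.sum_congr rfl fun k _ => ?_
      simp only [eval_add, eval_mul, eval_C, eval_map_algebraMap]
      ring
    rw [rescaledKernel, hk, he]
    simp only [eval_mul, eval_pow, eval_sub, eval_X, eval_C]
    ring
  have he : Complex.exp (2 * (a : ℂ) ^ 2 - 2 * z * a - 2 * w * a)
      = Complex.exp (2 * (a : ℂ) ^ 2 - 2 * w * a) * Complex.exp (-2 * z * a) := by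
    rw [← Complex.exp_add]; congr 1; ring
  have h2 : (bargmannOp (a : ℂ) K).eval z = ∑ k ∈ Finset.range N,
      (aeval z (bargmannOp a (q (2 * k + 1))) * aeval w (q (2 * k))
        - aeval z (bargmannOp a (q (2 * k))) * aeval w (q (2 * k + 1))) / (r k : ℂ) := by
    rw [hK, bargmannOp_sum, eval_finsetSum]
    refine Finset.sum_congr rfl fun k _ => ?_
    rw [bargmannOp_add, bargmannOp_C_mul, bargmannOp_C_mul, bargmannOp_map, bargmannOp_map]
    simp only [eval_add, eval_mul, eval_C, eval_map_algebraMap]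
    ring
  rw [h1, preOperator_exp_mul_eval, twistOp_cube_mul, eval_mul, h2, he]
  simp only [eval_mul, eval_pow, eval_sub, eval_X, eval_C, eval_neg, eval_ofNat]
  ring

/-! ### The reproducing property and its consequences -/

/-- Both sides are linear in `f`, so it is enough to test the members of the family, where
skew-orthogonality leaves one summand. -/
lemma aeval_eq_sum_of_isPlanarSOP {a : ℝ} {q : ℕ → ℝ[X]} {r : ℕ → ℝ}
    (h : IsPlanarSOP (preWeight (a : ℂ)) q r) (N : ℕ) (w : ℂ) :
    ∀ f ∈ degreeLT ℝ (2 * N), aeval w f = ∑ k ∈ Finset.range N,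
      (preForm a f (q (2 * k + 1)) * aeval w (q (2 * k))
        - preForm a f (q (2 * k)) * aeval w (q (2 * k + 1))) / (r k : ℂ) := by
  have hee : ∀ k l, preForm a (q (2 * k)) (q (2 * l)) = 0 := fun k l => by
    have := h.even_even k l
    rw [skewProduct_preWeight] at this
    exact_mod_cast this
  have hoo : ∀ k l, preForm a (q (2 * k + 1)) (q (2 * l + 1)) = 0 := fun k l => by
    have := h.odd_odd k l
    rw [skewProduct_preWeight] at this
    exact_mod_cast this
  have heo : ∀ k l, (preForm a (q (2 * k)) (q (2 * l + 1)) : ℂ) = if k = l then (r k : ℂ) else 0 :=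
    fun k l => by
      have := h.even_odd k l
      rwa [skewProduct_preWeight] at this
  have hoe : ∀ k l, (preForm a (q (2 * l + 1)) (q (2 * k)) : ℂ)
      = -(if k = l then (r k : ℂ) else 0) := fun k l => by
    have := h.odd_even k l
    rwa [skewProduct_preWeight] at this
  have hr : ∀ k, (r k : ℂ) ≠ 0 := fun k => by exact_mod_cast (h.norm_pos k).ne'
  refine degreeLT_induction q h.degree_eq ?_ ?_ ?_ _ ?_
  · have : ∀ g, preForm a 0 g = 0 := fun g => by
      simpa using preForm_C_mul_left a 0 0 g
    simp [this]
  · intro f g hf hg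
    rw [map_add, hf, hg, ← Finset.sum_add_distrib]
    refine Finset.sum_congr rfl fun k _ => ?_
    rw [preForm_add_left, preForm_add_left]
    push_cast
    ring
  · intro c f hf
    rw [map_mul, hf, Finset.mul_sum]
    refine Finset.sum_congr rfl fun k _ => ?_
    rw [preForm_C_mul_left, preForm_C_mul_left, aeval_C, Complex.coe_algebraMap]
    push_cast
    ring
  · intro j hj
    rcases Nat.even_or_odd' j with ⟨l, rfl | rfl⟩
    · rw [Finset.sum_eq_single l]
      · rw [hee, heo, if_pos rfl]
        field_simp [hr l]
        simp
      · intro k _ hk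
        rw [hee, heo, if_neg hk.symm]
        simp
      · intro hl
        exact absurd (Finset.mem_range.mpr (by omega)) hl
    · rw [Finset.sum_eq_single l]
      · rw [hoo, hoe, if_pos rfl]
        field_simp [hr l]
        simp
      · intro k _ hk
        rw [hoo, hoe, if_neg hk]
        simp
      · intro hl
        exact absurd (Finset.mem_range.mpr (by omega)) hl

lemma aeval_bargmannOp (a : ℝ) (n : ℕ) (f : ℝ[X]) (hf : f.natDegree < 2 * n + 2) (z : ℂ) :
    aeval z (bargmannOp a f) = ∑ j ∈ Finset.range (2 * n + 2),
        (preForm a f (X ^ j) : ℂ) * (2 * ((2 * z) ^ j / (j ! : ℂ)))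
      + ((-2 * a * f.coeff (2 * n) + (2 * n + 5 + 2 * a ^ 2) * f.coeff (2 * n + 1) : ℝ) : ℂ)
        * z ^ (2 * n + 2)
      + ((-2 * a * f.coeff (2 * n + 1) : ℝ) : ℂ) * z ^ (2 * n + 3) := by
  have h0 : ∀ m, 2 * n + 2 ≤ m → f.coeff m = 0 := fun m hm =>
    coeff_eq_zero_of_natDegree_lt (by omega)
  have hdeg : (bargmannOp a f).natDegree < 2 * n + 4 := by
    rw [Nat.lt_succ_iff, natDegree_le_iff_coeff_eq_zero]
    intro m hm
    obtain ⟨j, rfl⟩ : ∃ j, m = j + 2 := ⟨m - 2, by omega⟩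
    rw [coeff_bargmannOp, h0 j (by omega), h0 (j + 1) (by omega), h0 (j + 3) (by omega),
      h0 (j + 4) (by omega)]
    ring
  rw [aeval_eq_sum_range' hdeg, show 2 * n + 4 = 2 * n + 2 + 1 + 1 by ring,
    Finset.sum_range_succ, Finset.sum_range_succ, coeff_bargmannOp,
    show 2 * n + 2 + 1 = 2 * n + 1 + 2 by ring, coeff_bargmannOp, h0 (2 * n + 3) (by omega),
    h0 (2 * n + 4) (by omega), h0 (2 * n + 1 + 1) (by omega),
    h0 (2 * n + 1 + 4) (by omega)]
  congr 1
  · congr 1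
    · refine Finset.sum_congr rfl fun j _ => ?_
      rw [preForm_X_pow, Complex.real_smul]
      have h1 : (j ! : ℂ) ≠ 0 := by exact_mod_cast j.factorial_ne_zero
      push_cast
      rw [mul_pow]
      field_simp
      ring
    · rw [Complex.real_smul]
      push_cast
      ring
  · rw [Complex.real_smul]
    push_cast
    ring

/-- Every coefficient in $z$ is a skew-product of $q_k$ with $X^j$, $F$ or $G$, up to a constant;
the reproducing property replaces the sum over the family by the value of that polynomial at $w$. -/
lemma sum_bargmannOp_eq {a : ℝ} {q : ℕ → ℝ[X]} {r : ℕ → ℝ}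
    (h : IsPlanarSOP (preWeight (a : ℂ)) q r) (n : ℕ) (F G : ℝ[X])
    (hFd : F.natDegree < 2 * n + 2) (hGd : G.natDegree < 2 * n + 2)
    (hF : ∀ g : ℝ[X], g.natDegree < 2 * n + 2 →
      preForm a F g = topNorm a n * g.coeff (2 * n + 1))
    (hG : ∀ g : ℝ[X], g.natDegree < 2 * n + 2 → preForm a G g = -topNorm a n
      * ((2 * n + 5 + 2 * a ^ 2) * g.coeff (2 * n + 1) - 2 * a * g.coeff (2 * n))) (z w : ℂ) :
    ∑ k ∈ Finset.range (n + 1), (aeval z (bargmannOp a (q (2 * k + 1))) * aeval w (q (2 * k))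
        - aeval z (bargmannOp a (q (2 * k))) * aeval w (q (2 * k + 1))) / (r k : ℂ)
      = -2 * ∑ j ∈ Finset.range (2 * n + 2), (2 * z * w) ^ j / (j ! : ℂ)
        - aeval w G / (topNorm a n : ℂ) * z ^ (2 * n + 2)
        - 2 * a * (aeval w F / (topNorm a n : ℂ)) * z ^ (2 * n + 3) := by
  have hmem : ∀ f : ℝ[X], f.natDegree < 2 * n + 2 → f ∈ degreeLT ℝ (2 * (n + 1)) := by
    intro f hf
    rw [mem_degreeLT]
    exact degree_le_natDegree.trans_lt (by exact_mod_cast (by omega : f.natDegree < 2 * (n + 1)))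
  have hexp := aeval_eq_sum_of_isPlanarSOP h (n + 1) w
  have hT : (topNorm a n : ℂ) ≠ 0 := by exact_mod_cast (topNorm_pos a n).ne'
  have hqd : ∀ j, (q j).natDegree = j := fun j => natDegree_eq_of_degree_eq_some (h.degree_eq j)
  have hX : ∀ j ∈ Finset.range (2 * n + 2), (2 * z * w) ^ j / (j ! : ℂ)
      = ∑ k ∈ Finset.range (n + 1), (preForm a (X ^ j) (q (2 * k + 1)) * aeval w (q (2 * k))
        - preForm a (X ^ j) (q (2 * k)) * aeval w (q (2 * k + 1))) / (r k : ℂ)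
          * ((2 * z) ^ j / (j ! : ℂ)) := by
    intro j hj
    have := hexp (X ^ j) (hmem _ (by rw [natDegree_X_pow]; exact Finset.mem_range.mp hj))
    rw [← Finset.sum_mul, ← this, map_pow, aeval_X, mul_pow]
    ring
  rw [hexp G (hmem G hGd), hexp F (hmem F hFd), Finset.sum_congr rfl hX, Finset.sum_comm,
    Finset.mul_sum, Finset.sum_div, Finset.sum_div, Finset.sum_mul, Finset.mul_sum,
    Finset.sum_mul, ← Finset.sum_sub_distrib, ← Finset.sum_sub_distrib]
  -- The values at $w$ have been expanded in the family, so both sides agree summand by summand.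
  refine Finset.sum_congr rfl fun k hk => ?_
  have hk' := Finset.mem_range.mp hk
  have hd0 : (q (2 * k)).natDegree < 2 * n + 2 := by rw [hqd]; omega
  have hd1 : (q (2 * k + 1)).natDegree < 2 * n + 2 := by rw [hqd]; omega
  rw [aeval_bargmannOp a n _ hd0, aeval_bargmannOp a n _ hd1, hF _ hd0, hF _ hd1, hG _ hd0,
    hG _ hd1]
  have hr : (r k : ℂ) ≠ 0 := by exact_mod_cast (h.norm_pos k).ne'
  have hsum : ∀ u v : ℂ, ∑ j ∈ Finset.range (2 * n + 2),
      ((preForm a (X ^ j) (q (2 * k + 1)) * u - preForm a (X ^ j) (q (2 * k)) * v) / (r k : ℂ)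
        * ((2 * z) ^ j / (j ! : ℂ)))
      = -(((∑ j ∈ Finset.range (2 * n + 2),
          (preForm a (q (2 * k + 1)) (X ^ j) : ℂ) * (2 * ((2 * z) ^ j / (j ! : ℂ)))) * u
        - (∑ j ∈ Finset.range (2 * n + 2),
          (preForm a (q (2 * k)) (X ^ j) : ℂ) * (2 * ((2 * z) ^ j / (j ! : ℂ)))) * v)
          / (r k : ℂ)) / 2 := by
    intro u v
    rw [Finset.sum_mul, Finset.sum_mul, ← Finset.sum_sub_distrib, Finset.sum_div,
      ← Finset.sum_neg_distrib, Finset.sum_div]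
    refine Finset.sum_congr rfl fun j _ => ?_
    rw [preForm_comm a (X ^ j), preForm_comm a (X ^ j)]
    push_cast
    ring
  rw [hsum]
  generalize ∑ j ∈ Finset.range (2 * n + 2), (preForm a (q (2 * k + 1)) (X ^ j) : ℂ)
    * (2 * ((2 * z) ^ j / (j ! : ℂ))) = S1
  generalize ∑ j ∈ Finset.range (2 * n + 2), (preForm a (q (2 * k)) (X ^ j) : ℂ)
    * (2 * ((2 * z) ^ j / (j ! : ℂ))) = S0
  push_cast
  field_simp
  ring

/-! ### Assembly of the four terms -/

theorem theorem2p6 (a : ℝ) :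
    (∃ (q : ℕ → Polynomial ℝ) (r : ℕ → ℝ), IsPlanarSOP (preWeight (a : ℂ)) q r) ∧
    ∀ (q : ℕ → Polynomial ℝ) (r : ℕ → ℝ), IsPlanarSOP (preWeight (a : ℂ)) q r →
      ∀ N : ℕ, 1 ≤ N → ∀ z w : ℂ,
        preOperator (a : ℂ) (fun t : ℂ => rescaledKernel (a : ℂ) (skewKernel q r N) t w) z
          = termI (a : ℂ) N z w - termII (a : ℂ) N z w
            - termIII (a : ℂ) N z w + termIV (a : ℂ) N z w := by
  refine ⟨exists_isPlanarSOP a, fun q r h N hN z w => ?_⟩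
  obtain ⟨n, rfl⟩ : ∃ n, N = n + 1 := ⟨N - 1, by omega⟩
  obtain ⟨F, hF, hFd, -, hFT⟩ := exists_topPoly a n
  obtain ⟨G, hG, hGd, hGT⟩ := exists_subPoly a n
  rw [preOperator_rescaledKernel, sum_bargmannOp_eq h n F G (by omega) hGd
    (fun g hg => preForm_topPoly a n F g hg hFT) (fun g hg => preForm_subPoly a n G g hg hGT)]
  have hFw := congrArg (aeval w) hF
  have hGw := congrArg (aeval w) hG
  simp only [topNumerator, subNumerator, map_add, map_mul, map_sub, map_pow, aeval_C, aeval_X,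
    Complex.coe_algebraMap] at hFw hGw
  have hf0 : (fReal (n + 2) (a ^ 2) : ℂ) ≠ 0 := by
    exact_mod_cast (fReal_pos (n + 1) (a ^ 2) (sq_nonneg a)).ne'
  have hn0 : (((n + 1)! : ℕ) : ℂ) ≠ 0 := by exact_mod_cast (n + 1).factorial_ne_zero
  have hpow : (oddCoeff (n + 1) : ℂ)
      = 2 ^ (2 * n + 1) * 2 * (((n + 1)! : ℕ) : ℂ) / (((2 * n + 2)! : ℕ) : ℂ) := by
    have h4 : (4 : ℂ) ^ (n + 1) = 2 ^ (2 * n + 1) * 2 := by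
      rw [← pow_succ, show 2 * n + 1 + 1 = 2 * (n + 1) by ring, pow_mul]; norm_num
    rw [oddCoeff, ← h4, show 2 * (n + 1) = 2 * n + 2 by ring]
    push_cast
    rfl
  -- Term II in the constants of the numerators, using $2^{2N}/(2N)!=$ `oddCoeff N` $/N!$.
  have hII : termII (a : ℂ) (n + 1) z w = 4 * a * (z - a) ^ 3 * (w - a) ^ 2
      * Complex.exp (2 * a ^ 2 - 2 * z * a - 2 * w * a)
      * ((oddCoeff (n + 1) : ℂ) / ((((n + 1)! : ℕ) : ℂ) * (fReal (n + 2) (a ^ 2) : ℂ))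
        * (z * w) ^ (2 * n + 2) * ((fReal (n + 2) (a ^ 2) : ℂ)
          + (2 * (n : ℂ) + 3 - 2 * a * z) * (expSum (n + 2) (a ^ 2) : ℂ) / 2)) := by
    rw [termII, truncExp_eq, fSum_eq, hpow, show 2 * (n + 1) - 1 = 2 * n + 1 by omega,
      show 2 * (n + 1) = 2 * n + 2 by ring, show n + 1 + 1 = n + 2 by ring, mul_assoc 2 z w, mul_pow 2,
      pow_succ 2 (2 * n + 1)]
    push_cast
    field_simp
    ring
  -- The factor $e^{-2zw}$ of $Q(2N,2zw)$ turns the exponential of term I into that of the rescaled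
  -- kernel.
  have heI : Complex.exp (2 * (z - a) * (w - a)) * Complex.exp (-(2 * z * w))
      = Complex.exp (2 * (a : ℂ) ^ 2 - 2 * z * a - 2 * w * a) := by
    rw [← Complex.exp_add]; congr 1; ring
  have heL : Complex.exp (2 * (a : ℂ) ^ 2 - 2 * z * a - 2 * w * a)
      = Complex.exp (2 * (a : ℂ) ^ 2 - 2 * z * a) * Complex.exp (-2 * w * a) := by
    rw [← Complex.exp_add]; congr 1; ring
  rw [hII, termI, termIII, termIV, LHat_eq, LHat_eq, fSum_eq,
    show 2 * (n + 1) = 2 * n + 1 + 1 by ring, regGammaQ_eq]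
  have hI : 4 * (z - a) ^ 3 * (w - a) ^ 3 * Complex.exp (2 * (z - a) * (w - a))
      * (Complex.exp (-(2 * z * w))
        * ∑ j ∈ Finset.range (2 * n + 1 + 1), (2 * z * w) ^ j / (j ! : ℂ))
      = 4 * (z - a) ^ 3 * (w - a) ^ 3 * (Complex.exp (2 * (a : ℂ) ^ 2 - 2 * z * a)
        * Complex.exp (-2 * w * a))
        * ∑ j ∈ Finset.range (2 * n + 1 + 1), (2 * z * w) ^ j / (j ! : ℂ) := by
    rw [← heL, ← heI]; ring
  rw [hI, heL]
  rw [show n + 1 + 1 = n + 2 by ring]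
  generalize ∑ j ∈ Finset.range (2 * n + 1 + 1), (2 * z * w) ^ j / (j ! : ℂ) = S
  generalize Complex.exp (2 * (a : ℂ) ^ 2 - 2 * z * a) = E1
  generalize Complex.exp (-2 * w * a) = E2
  generalize aeval w (ginWronskian a (n + 2)) = M2 at *
  generalize aeval w (ginWronskian a (n + 1)) = M1 at *
  generalize aeval w F = Fw at *
  generalize aeval w G = Gw at *
  have hT : (topNorm a n : ℂ) = 4 * (((n + 1)! : ℕ) : ℂ) * (fReal (n + 2) (a ^ 2) : ℂ) := by
    rw [topNorm]; push_cast; ring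
  rw [hT]
  push_cast at hFw hGw ⊢
  generalize (((n + 1)! : ℕ) : ℂ) = T at *
  generalize (fReal (n + 2) (a ^ 2) : ℂ) = f at *
  generalize (oddCoeff (n + 1) : ℂ) = d at *
  generalize (expSum (n + 2) (a ^ 2) : ℂ) = e at *
  -- The prefactor $(w-a)^3$ turns $F(w)$ and $G(w)$ into the numerators, so nothing is divided by
  -- $w-a$ and $w=a$ needs no separate case.
  linear_combination (-((z - a) ^ 3 * E1 * E2 * z ^ (2 * n + 2) / (2 * T * f))) * hGw
    - ((z - a) ^ 3 * E1 * E2 * a * z ^ (2 * n + 3) / (T * f)) * hFw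

end
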